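/- Let $(M^{n+1},g_{ab})$, $n\ge 2$, be a spacetime, i.e. a smooth Lorentzian manifold of signature $(-,+,\dots,+)$, time oriented by an everywhere causal vector field, with Levi-Civita connection $\nabla$. Let $g:M\to\mathbb R$ be a $C^2$ function whose gradient $\nabla^a g$ is future null (nonzero, null and future pointing) at every point of $M$, and let $\Box g=g^{ab}\nabla_a\nabla_b g$. Then: 1. The set $\{\Box g>0\}$ is open, and for every $c\in\mathbb R$ the level set $\Sigma_c=\{p\in M:\Box g(p)>0,\ g(p)=c\}$ is (empty or) an embedded null hypersurface which is strictly $(n-1)$-future convex. 2. For every $p\in M$ and every section $V_o$ of the tangent space $T_p\Sigma$ at $p$ of the level set $\Sigma$ of $g$ through $p$ (that is, every $(n-1)$-dimensional subspace $V_o\subset T_p\Sigma$ on which the metric is positive definite), $\Box g(p)$ equals the trace $h_o^{ij}e_i^ae_j^b\nabla_a\nabla_b g$ of $\nabla_a\nabla_b g$ over $V_o$, where $e_1,\dots,e_{n-1}$ is any basis of $V_o$ and $h_o^{ij}$ is the inverse of the matrix $g_{ab}e_i^ae_j^b$. Here a hypersurface $\Sigma$ is null if it has a null normal vector at each of its points,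 and spacelike/null if it has a causal normal vector at each of its points. A spacelike/null hypersurface $\Sigma$ is strictly $k$-future convex if for every $p\in\Sigma$ and every $k$-dimensional subspace $W\subset T_p\Sigma$ on which the metric is positive definite, $h^{\alpha\beta}e^a_\alpha e^b_\beta\nabla_aN_b>0$ at $p$, where $N^a$ is a future pointing vector field normal to $\Sigma$ (the condition does not depend on which), $e_1,\dots,e_k$ is a basis of $W$, and $h^{\alpha\beta}$ is the inverse of the matrix $g_{ab}e^a_\alpha e^b_\beta$. -/

import Mathlib

open Bundle Manifold Filter Topology
open scoped ContDiff

noncomputable section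

/-- An `(n+1)`-dimensional spacetime structure on the smooth (boundaryless) manifold `M`: a smooth
Lorentzian metric of signature `(-,+,…,+)` and a time orientation, given by an everywhere causal
vector field. -/
structure Spacetime (n : ℕ) (M : Type*) [TopologicalSpace M]
    [ChartedSpace (EuclideanSpace ℝ (Fin (n + 1))) M] [IsManifold (𝓡 (n + 1)) ∞ M] where
  /-- The metric `⟨u, v⟩ = g_ab u^a v^b`. -/
  metric (x : M) : TangentSpace (𝓡 (n + 1)) x →L[ℝ] TangentSpace (𝓡 (n + 1)) x →L[ℝ] ℝ
  symm (x : M) (u v : TangentSpace (𝓡 (n + 1)) x) : metric x u v = metric x v u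
  smooth : ContMDiff (𝓡 (n + 1))
    ((𝓡 (n + 1)).prod 𝓘(ℝ, EuclideanSpace ℝ (Fin (n + 1)) →L[ℝ]
      EuclideanSpace ℝ (Fin (n + 1)) →L[ℝ] ℝ)) ∞
    (fun x ↦ TotalSpace.mk' (EuclideanSpace ℝ (Fin (n + 1)) →L[ℝ]
      EuclideanSpace ℝ (Fin (n + 1)) →L[ℝ] ℝ)
      (E := fun y : M ↦ TangentSpace (𝓡 (n + 1)) y →L[ℝ] TangentSpace (𝓡 (n + 1)) y →L[ℝ] ℝ)
      x (metric x))
  /-- Signature `(-,+,…,+)`: there is a vector of negative square whose orthogonal complement is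
  positive definite. -/
  lorentzian (x : M) : ∃ t : TangentSpace (𝓡 (n + 1)) x, metric x t t < 0 ∧
    ∀ v : TangentSpace (𝓡 (n + 1)) x, metric x t v = 0 → v ≠ 0 → 0 < metric x v v
  /-- The vector field that selects the future half of the causal cone. -/
  orient (x : M) : TangentSpace (𝓡 (n + 1)) x
  orient_continuous : Continuous
    (fun x ↦ (⟨x, orient x⟩ : TangentBundle (𝓡 (n + 1)) M))
  orient_causal (x : M) : orient x ≠ 0 ∧ metric x (orient x) (orient x) ≤ 0

namespace Spacetime

variable {n : ℕ} {M : Type*} [TopologicalSpace M]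
  [ChartedSpace (EuclideanSpace ℝ (Fin (n + 1))) M] [IsManifold (𝓡 (n + 1)) ∞ M]

section Causality

variable (S : Spacetime n M) {p : M}

/-- `v` is causal: nonzero with `⟨v, v⟩ ≤ 0`. -/
def IsCausal (v : TangentSpace (𝓡 (n + 1)) p) : Prop :=
  v ≠ 0 ∧ S.metric p v v ≤ 0

/-- `v` is null: nonzero with `⟨v, v⟩ = 0`. -/
def IsNull (v : TangentSpace (𝓡 (n + 1)) p) : Prop :=
  v ≠ 0 ∧ S.metric p v v = 0

/-- `v` is future causal: it is causal and lies in the same half cone as the time orientation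
`o`, i.e. `⟨o, v⟩ < 0`, or `v` is a positive multiple of `o` (the latter being needed only when
`o` is null). -/
def IsFuture (v : TangentSpace (𝓡 (n + 1)) p) : Prop :=
  S.IsCausal v ∧ (S.metric p (S.orient p) v < 0 ∨ ∃ c : ℝ, 0 < c ∧ v = c • S.orient p)

/-- A subspace of `T_pM` is spacelike if the metric is positive definite on it. -/
def IsSpacelike (W : Submodule ℝ (TangentSpace (𝓡 (n + 1)) p)) : Prop :=
  ∀ v ∈ W, v ≠ 0 → 0 < S.metric p v v

end Causality

section LinearAlgebra

variable (S : Spacetime n M)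

theorem metric_nondegenerate (p : M) (u : TangentSpace (𝓡 (n + 1)) p)
    (hu : ∀ v, S.metric p u v = 0) : u = 0 := by
  obtain ⟨t, -, ht⟩ := S.lorentzian p
  by_contra hne
  have h1 := ht u (by rw [S.symm, hu]) hne
  rw [hu u] at h1
  exact lt_irrefl _ h1

/-- Lowering an index, `u^a ↦ u_a = g_ab u^b`, as a linear isomorphism `T_pM ≃ T_p^*M`. -/
def lower (p : M) :
    TangentSpace (𝓡 (n + 1)) p ≃ₗ[ℝ] (TangentSpace (𝓡 (n + 1)) p →ₗ[ℝ] ℝ) :=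
  haveI : FiniteDimensional ℝ (TangentSpace (𝓡 (n + 1)) p) :=
    inferInstanceAs (FiniteDimensional ℝ (EuclideanSpace ℝ (Fin (n + 1))))
  LinearEquiv.ofInjectiveOfFinrankEq
    { toFun := fun u ↦ (S.metric p u : TangentSpace (𝓡 (n + 1)) p →ₗ[ℝ] ℝ)
      map_add' := fun u v ↦ by ext w; simp
      map_smul' := fun c u ↦ by ext w; simp }
    (by
      rw [← LinearMap.ker_eq_bot, LinearMap.ker_eq_bot']
      intro u hu
      exact S.metric_nondegenerate p u fun v ↦ LinearMap.congr_fun hu v)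
    (Subspace.dual_finrank_eq).symm

theorem lower_apply (p : M) (u v : TangentSpace (𝓡 (n + 1)) p) :
    S.lower p u v = S.metric p u v := rfl

/-- Raising an index. -/
def raise (p : M) (α : TangentSpace (𝓡 (n + 1)) p →ₗ[ℝ] ℝ) : TangentSpace (𝓡 (n + 1)) p :=
  (S.lower p).symm α

theorem metric_raise (p : M) (α : TangentSpace (𝓡 (n + 1)) p →ₗ[ℝ] ℝ)
    (v : TangentSpace (𝓡 (n + 1)) p) : S.metric p (S.raise p α) v = α v := by
  rw [← lower_apply, raise, LinearEquiv.apply_symm_apply]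

/-- The trace `h^{αβ} K(e_α, e_β)` of `K` on the span of `e_1, …, e_k`, where `h^{αβ}` is the
inverse of the Gram matrix `h_{αβ} = ⟨e_α, e_β⟩`. -/
def traceOn {p : M} {k : ℕ} (e : Fin k → TangentSpace (𝓡 (n + 1)) p)
    (K : TangentSpace (𝓡 (n + 1)) p → TangentSpace (𝓡 (n + 1)) p → ℝ) : ℝ :=
  ∑ α, ∑ β, (Matrix.of fun i j ↦ S.metric p (e i) (e j))⁻¹ α β * K (e α) (e β)

end LinearAlgebra

section LeviCivita

/-- The vector field `X` is differentiable at `p`. -/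
abbrev DiffAt (X : Π x : M, TangentSpace (𝓡 (n + 1)) x) (p : M) : Prop :=
  MDifferentiableAt (𝓡 (n + 1)) (𝓡 (n + 1)).tangent
    (fun x ↦ (⟨x, X x⟩ : TangentBundle (𝓡 (n + 1)) M)) p

variable (S : Spacetime n M)

/-- The function `⟨X, Y⟩` for vector fields `X`, `Y`. -/
def pairing (X Y : Π x : M, TangentSpace (𝓡 (n + 1)) x) (x : M) : ℝ :=
  S.metric x (X x) (Y x)

theorem pairing_mdifferentiableAt {X Y : Π x : M, TangentSpace (𝓡 (n + 1)) x} {p : M}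
    (hX : DiffAt X p) (hY : DiffAt Y p) :
    MDifferentiableAt (𝓡 (n + 1)) 𝓘(ℝ, ℝ) (S.pairing X Y) p := by
  have h : MDifferentiableAt (𝓡 (n + 1)) ((𝓡 (n + 1)).prod 𝓘(ℝ, ℝ))
      (fun m ↦ TotalSpace.mk' ℝ (E := Bundle.Trivial M ℝ) m (S.metric m (X m) (Y m))) p := by
    apply MDifferentiableAt.clm_bundle_apply₂ (F₁ := EuclideanSpace ℝ (Fin (n + 1)))
      (F₂ := EuclideanSpace ℝ (Fin (n + 1)))
    · exact S.smooth.contMDiffAt.mdifferentiableAt (by simp)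
    · exact hX
    · exact hY
  simp only [mdifferentiableAt_totalSpace] at h
  exact h.2

/-- The right-hand side of the Koszul formula: for the Levi-Civita connection,
`⟨∇_X Y, Z⟩ = ½ (X⟨Y,Z⟩ + Y⟨X,Z⟩ - Z⟨X,Y⟩ + ⟨[X,Y],Z⟩ - ⟨[X,Z],Y⟩ - ⟨[Y,Z],X⟩)`. -/
def koszul (p : M) (Y X Z : Π x : M, TangentSpace (𝓡 (n + 1)) x) : ℝ :=
  (mvfderiv (𝓡 (n + 1)) (S.pairing Y Z) p (X p)
    + mvfderiv (𝓡 (n + 1)) (S.pairing X Z) p (Y p)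
    - mvfderiv (𝓡 (n + 1)) (S.pairing X Y) p (Z p)
    + S.metric p (VectorField.mlieBracket (𝓡 (n + 1)) X Y p) (Z p)
    - S.metric p (VectorField.mlieBracket (𝓡 (n + 1)) X Z p) (Y p)
    - S.metric p (VectorField.mlieBracket (𝓡 (n + 1)) Y Z p) (X p)) / 2

theorem pairing_add_left (X X' Y : Π x : M, TangentSpace (𝓡 (n + 1)) x) :
    S.pairing (X + X') Y = fun x ↦ S.pairing X Y x + S.pairing X' Y x := by
  ext x; simp [pairing]

theorem pairing_smul_left (f : M → ℝ) (X Y : Π x : M, TangentSpace (𝓡 (n + 1)) x) :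
    S.pairing (f • X) Y = fun x ↦ f x * S.pairing X Y x := by
  ext x; simp [pairing]

theorem pairing_comm (X Y : Π x : M, TangentSpace (𝓡 (n + 1)) x) :
    S.pairing X Y = S.pairing Y X := by
  ext x; exact S.symm x _ _

theorem koszul_tensorial_left (p : M) (Y : Π x : M, TangentSpace (𝓡 (n + 1)) x)
    (hY : DiffAt Y p) (Z : Π x : M, TangentSpace (𝓡 (n + 1)) x) (hZ : DiffAt Z p) :
    TensorialAt (𝓡 (n + 1)) (EuclideanSpace ℝ (Fin (n + 1))) (fun X ↦ S.koszul p Y X Z) p where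
  smul {f X} hf hX := by
    simp only [koszul, pairing_smul_left]
    rw [VectorField.mlieBracket_smul_left hf hX, VectorField.mlieBracket_smul_left hf hX,
      mvfderiv_fun_mul hf (S.pairing_mdifferentiableAt hX hZ),
      mvfderiv_fun_mul hf (S.pairing_mdifferentiableAt hX hY)]
    simp [pairing]
    ring
  add {X X'} hX hX' := by
    simp only [koszul, pairing_add_left]
    rw [VectorField.mlieBracket_add_left hX hX', VectorField.mlieBracket_add_left hX hX',
      mvfderiv_fun_add (S.pairing_mdifferentiableAt hX hZ) (S.pairing_mdifferentiableAt hX' hZ),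
      mvfderiv_fun_add (S.pairing_mdifferentiableAt hX hY) (S.pairing_mdifferentiableAt hX' hY)]
    simp
    ring

theorem koszul_tensorial_right (p : M) (Y : Π x : M, TangentSpace (𝓡 (n + 1)) x)
    (hY : DiffAt Y p) (X : Π x : M, TangentSpace (𝓡 (n + 1)) x) (hX : DiffAt X p) :
    TensorialAt (𝓡 (n + 1)) (EuclideanSpace ℝ (Fin (n + 1))) (fun Z ↦ S.koszul p Y X Z) p where
  smul {f Z} hf hZ := by
    simp only [koszul, S.pairing_comm _ (f • Z), pairing_smul_left]
    rw [VectorField.mlieBracket_smul_right hf hZ, VectorField.mlieBracket_smul_right hf hZ,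
      mvfderiv_fun_mul hf (S.pairing_mdifferentiableAt hZ hX),
      mvfderiv_fun_mul hf (S.pairing_mdifferentiableAt hZ hY), S.pairing_comm Z X,
      S.pairing_comm Z Y]
    simp [pairing, S.symm p (Z p) (X p), S.symm p (Z p) (Y p)]
    ring
  add {Z Z'} hZ hZ' := by
    simp only [koszul, S.pairing_comm _ (Z + Z'), pairing_add_left]
    rw [VectorField.mlieBracket_add_right hZ hZ', VectorField.mlieBracket_add_right hZ hZ',
      mvfderiv_fun_add (S.pairing_mdifferentiableAt hZ hX) (S.pairing_mdifferentiableAt hZ' hX),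
      mvfderiv_fun_add (S.pairing_mdifferentiableAt hZ hY) (S.pairing_mdifferentiableAt hZ' hY),
      S.pairing_comm Z X, S.pairing_comm Z' X, S.pairing_comm Z Y, S.pairing_comm Z' Y]
    simp
    ring

open Classical in
/-- The tensor `∇_a N_b` at `p`, for the Levi-Civita connection of the metric:
`(u, w) ↦ u^a w^b ∇_a N_b = ⟨∇_u N, w⟩`, defined by the Koszul formula (with junk value `0` if `N`
is not differentiable at `p`). -/
def nablaLower (N : Π x : M, TangentSpace (𝓡 (n + 1)) x) (p : M) :
    TangentSpace (𝓡 (n + 1)) p →L[ℝ] TangentSpace (𝓡 (n + 1)) p →L[ℝ] ℝ :=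
  if hN : DiffAt N p then
    TensorialAt.mkHom₂ (S.koszul p N) p
      (fun Z hZ ↦ S.koszul_tensorial_left p N hN Z hZ)
      (fun X hX ↦ S.koszul_tensorial_right p N hN X hX)
  else 0

/-- The endomorphism `u ↦ ∇_u N` of `T_pM`. -/
def nabla (N : Π x : M, TangentSpace (𝓡 (n + 1)) x) (p : M) :
    TangentSpace (𝓡 (n + 1)) p →ₗ[ℝ] TangentSpace (𝓡 (n + 1)) p where
  toFun u := S.raise p (S.nablaLower N p u)
  map_add' u v := by simp [raise]
  map_smul' c u := by simp [raise]

/-- The Koszul formula holds for arbitrary vector fields `X`, `Z`, differentiable at `p`. -/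
theorem metric_nabla {N X Z : Π x : M, TangentSpace (𝓡 (n + 1)) x} {p : M}
    (hN : DiffAt N p) (hX : DiffAt X p) (hZ : DiffAt Z p) :
    S.metric p (S.nabla N p (X p)) (Z p) = S.koszul p N X Z := by
  have h : S.metric p (S.nabla N p (X p)) (Z p) = S.nablaLower N p (X p) (Z p) :=
    S.metric_raise p _ _
  rw [h, nablaLower, dif_pos hN]
  exact TensorialAt.mkHom₂_apply _ _ hX hZ

/-- The connection is torsion free. -/
theorem nabla_torsionFree {X Y : Π x : M, TangentSpace (𝓡 (n + 1)) x} {p : M}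
    (hX : DiffAt X p) (hY : DiffAt Y p) :
    S.nabla Y p (X p) - S.nabla X p (Y p) = VectorField.mlieBracket (𝓡 (n + 1)) X Y p := by
  rw [← sub_eq_zero]
  refine S.metric_nondegenerate p _ fun v ↦ ?_
  have hv := FiberBundle.extend_apply_self (F := EuclideanSpace ℝ (Fin (n + 1))) v
  have hZ : DiffAt (FiberBundle.extend (EuclideanSpace ℝ (Fin (n + 1))) v) p :=
    FiberBundle.mdifferentiableAt_extend ..
  rw [← hv]
  simp only [map_sub, sub_apply]
  rw [S.metric_nabla hY hX hZ, S.metric_nabla hX hY hZ, koszul, koszul, S.pairing_comm Y X,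
    VectorField.mlieBracket_swap_apply (V := Y) (W := X)]
  simp
  ring

/-- The connection is compatible with the metric. -/
theorem nabla_metric {X Y Z : Π x : M, TangentSpace (𝓡 (n + 1)) x} {p : M}
    (hX : DiffAt X p) (hY : DiffAt Y p) (hZ : DiffAt Z p) :
    mvfderiv (𝓡 (n + 1)) (S.pairing Y Z) p (X p) =
      S.metric p (S.nabla Y p (X p)) (Z p) + S.metric p (Y p) (S.nabla Z p (X p)) := by
  rw [S.symm p (Y p), S.metric_nabla hY hX hZ, S.metric_nabla hZ hX hY, koszul, koszul,
    S.pairing_comm Z Y, VectorField.mlieBracket_swap_apply (V := Z) (W := Y)]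
  simp
  ring

/-- The gradient vector field `∇^a f`. -/
def grad (f : M → ℝ) (p : M) : TangentSpace (𝓡 (n + 1)) p :=
  S.raise p (mvfderiv (𝓡 (n + 1)) f p : TangentSpace (𝓡 (n + 1)) p →L[ℝ] ℝ)

/-- The Hessian `∇_a ∇_b f`. -/
def hessian (f : M → ℝ) (p : M) (u w : TangentSpace (𝓡 (n + 1)) p) : ℝ :=
  S.metric p (S.nabla (S.grad f) p u) w

/-- The wave operator `□f = g^{ab} ∇_a ∇_b f = ∇_a ∇^a f`. -/
def box (f : M → ℝ) (p : M) : ℝ :=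
  LinearMap.trace ℝ (TangentSpace (𝓡 (n + 1)) p) (S.nabla (S.grad f) p)

end LeviCivita

section Hypersurfaces

/-- `H` is an embedded (boundaryless) hypersurface of class `C²`: around each of its points there
is a `C²` slice chart. -/
def IsHypersurface (n : ℕ) {M : Type*} [TopologicalSpace M]
    [ChartedSpace (EuclideanSpace ℝ (Fin (n + 1))) M] (H : Set M) : Prop :=
  ∀ p ∈ H, ∃ φ ∈ IsManifold.maximalAtlas (𝓡 (n + 1)) 2 M,
    p ∈ φ.source ∧ ∀ q ∈ φ.source, q ∈ H ↔ φ q 0 = 0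

/-- The tangent space `T_pH ⊆ T_pM`: the span of the velocities at `p` of `C¹` curves in `H`. -/
def tangentTo (n : ℕ) {M : Type*} [TopologicalSpace M]
    [ChartedSpace (EuclideanSpace ℝ (Fin (n + 1))) M] (H : Set M) (p : M) :
    Submodule ℝ (TangentSpace (𝓡 (n + 1)) p) :=
  Submodule.span ℝ {v | ∃ γ : ℝ → M, ContMDiffAt 𝓘(ℝ, ℝ) (𝓡 (n + 1)) 1 γ 0 ∧
    (∀ᶠ t in 𝓝 (0 : ℝ), γ t ∈ H) ∧
    tangentMap 𝓘(ℝ, ℝ) (𝓡 (n + 1)) γ ⟨0, (1 : ℝ)⟩ = ⟨p, v⟩}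

variable (S : Spacetime n M)

/-- `v` is normal to `H` at `p`. -/
def IsNormalTo (H : Set M) (p : M) (v : TangentSpace (𝓡 (n + 1)) p) : Prop :=
  ∀ u ∈ tangentTo n H p, S.metric p v u = 0

/-- A null hypersurface: at each point it has a null normal vector. -/
def IsNullHypersurface (H : Set M) : Prop :=
  IsHypersurface n H ∧ ∀ p ∈ H, ∃ v : TangentSpace (𝓡 (n + 1)) p, S.IsNull v ∧ S.IsNormalTo H p v

/-- A spacelike/null hypersurface: at each point it has a causal (timelike or null) normal
vector. -/
def IsSpacelikeNullHypersurface (H : Set M) : Prop :=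
  IsHypersurface n H ∧ ∀ p ∈ H, ∃ v : TangentSpace (𝓡 (n + 1)) p,
    S.IsCausal v ∧ S.IsNormalTo H p v

/-- Near `p`, `N` is a `C¹` vector field that is normal to `H` and future pointing along `H`. -/
def IsFutureNormalNear (H : Set M) (p : M) (N : Π x : M, TangentSpace (𝓡 (n + 1)) x) : Prop :=
  ContMDiffAt (𝓡 (n + 1)) (𝓡 (n + 1)).tangent 1
      (fun x ↦ (⟨x, N x⟩ : TangentBundle (𝓡 (n + 1)) M)) p ∧
    ∀ᶠ q in 𝓝[H] p, S.IsFuture (N q) ∧ S.IsNormalTo H q (N q)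

/-- `H` is strictly `k`-future convex at `p`: for any future normal field `N`, and any
`k`-dimensional spacelike subspace `W` of `T_pH` with basis `e`, `h^{αβ} e_α^a e_β^b ∇_a N_b > 0`.
(The condition does not depend on the choice of the future normal field; we ask that one exists and
that the inequality holds for all of them.) -/
def IsStrictlyFutureConvexAt (k : ℕ) (H : Set M) (p : M) : Prop :=
  (∃ N, S.IsFutureNormalNear H p N) ∧
  ∀ N, S.IsFutureNormalNear H p N →
    ∀ W : Submodule ℝ (TangentSpace (𝓡 (n + 1)) p), W ≤ tangentTo n H p → S.IsSpacelike W →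
      ∀ e : Module.Basis (Fin k) ℝ W,
        0 < S.traceOn (fun i ↦ (e i : TangentSpace (𝓡 (n + 1)) p))
          (fun u w ↦ S.metric p (S.nabla N p u) w)

/-- `H` is a strictly `k`-future convex spacelike/null hypersurface. -/
def IsStrictlyFutureConvex (k : ℕ) (H : Set M) : Prop :=
  S.IsSpacelikeNullHypersurface H ∧ ∀ p ∈ H, S.IsStrictlyFutureConvexAt k H p

end Hypersurfaces

end Spacetime

end

/-!
Write `k = ∇g` and let `A u = ∇_u k`, an endomorphism of `T_pM` with trace `□g`.

*The trace identity.* The Hessian `⟨A u, w⟩` is symmetric because the Levi-Civita connection is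
torsion free (`Spacetime.hessian_symm`). Differentiating `⟨k, k⟩ = 0` gives `⟨A u, k⟩ = 0` for all
`u`, hence, by symmetry, also `A k = 0` (`Spacetime.hessian_grad_right`,
`Spacetime.nabla_grad_grad`). A section `V` of `T_pΣ = k^⊥` is a maximal spacelike subspace of
`k^⊥`; with `P` the orthogonal projection onto `V`, the vectors `A u - P A u` lie in `k^⊥ ∩ V^⊥`,
which is the line of `k`. As `A k = 0`, the endomorphism `A - P A` has square zero, so
`tr A = tr (P A)`, and the latter is the trace of the Hessian over `V` (`gram_trace_eq_trace`).

*Convexity.* As `dg ≠ 0`, level sets of `g` are hypersurfaces whose tangent space is the kernel of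
`dg` (`Spacetime.exists_slice_chart`, `Spacetime.mem_tangentTo_level`), so that `k` is a null normal
vector. Any other future normal field `N` is, along the level set, a positive multiple of `k`, and
`⟨∇_u N, w⟩` is then the same multiple of the Hessian for `u`, `w` tangent to the level set
(`Spacetime.metric_nabla_of_parallel`); no regularity of the factor is needed, since it is enough to
differentiate the `2 × 2` minors of the components of `N` and `k`. So the convexity trace of `N` is
a positive multiple of `□g`.

*Openness.* `□g` is continuous (`Spacetime.continuous_box`): `k` is `C¹` because its inner products
with a coordinate frame are, and by the Koszul formula so are the components of `∇k` continuous.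
-/

/-! ### Traces over spacelike subspaces orthogonal to a null vector -/

section BilinearForms

variable {T : Type*} [AddCommGroup T] [Module ℝ T]

/-- The Gram matrix of a family is invertible as soon as the form is nondegenerate on the span of
the family in the sense that no nontrivial combination is orthogonal to the whole family. -/
theorem isUnit_det_gram {m : ℕ} (B : T →ₗ[ℝ] T →ₗ[ℝ] ℝ) (e : Fin m → T)
    (h : ∀ c : Fin m → ℝ, (∀ j, B (e j) (∑ i, c i • e i) = 0) → c = 0) :
    IsUnit (Matrix.of fun i j ↦ B (e i) (e j)).det := by
  rw [isUnit_iff_ne_zero]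
  intro hdet
  obtain ⟨c, hc, hGc⟩ := Matrix.exists_mulVec_eq_zero_iff.2 hdet
  refine hc (h c fun j ↦ ?_)
  have := congrFun hGc j
  simp only [Matrix.mulVec, dotProduct, Matrix.of_apply, Pi.zero_apply] at this
  simp only [map_sum, map_smul, smul_eq_mul]
  rw [← this]
  exact Finset.sum_congr rfl fun i _ ↦ mul_comm _ _

/-- Vectors of a Lorentzian-type space that are orthogonal to a null vector `k` and to a maximal
spacelike family in `k^⊥` are multiples of `k`. -/
theorem exists_smul_eq_of_orthogonal [FiniteDimensional ℝ T] {m : ℕ}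
    (hdim : Module.finrank ℝ T = m + 2)
    (B : LinearMap.BilinForm ℝ T) (hsymm : ∀ u v, B u v = B v u) (hnd : B.Nondegenerate)
    {k : T} (hk : k ≠ 0) (hkk : B k k = 0) (e : Fin m → T)
    (he : ∀ c : Fin m → ℝ, c ≠ 0 → 0 < B (∑ i, c i • e i) (∑ i, c i • e i))
    (hek : ∀ i, B (e i) k = 0) {y : T} (hye : ∀ i, B y (e i) = 0) (hyk : B y k = 0) :
    ∃ c : ℝ, c • k = y := by
  have hli : LinearIndependent ℝ (Fin.cons k e : Fin (m + 1) → T) := by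
    rw [linearIndependent_finCons]
    constructor
    · rw [Fintype.linearIndependent_iff]
      intro c hc i
      by_contra hi
      have := he c (fun h ↦ hi (by rw [h]; rfl))
      rw [hc] at this
      simp at this
    · intro hmem
      obtain ⟨c, hc⟩ := (Submodule.mem_span_range_iff_exists_fun ℝ).1 hmem
      by_cases h0 : c = 0
      · apply hk
        rw [← hc, h0]
        simp
      · have := he c h0
        rw [hc, hkk] at this
        exact lt_irrefl _ this
  set W := Submodule.span ℝ (Set.range (Fin.cons k e : Fin (m + 1) → T)) with hW
  have hWdim : Module.finrank ℝ W = m + 1 := by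
    rw [hW, finrank_span_eq_card hli, Fintype.card_fin]
  have hort : Module.finrank ℝ (B.orthogonal W) = 1 := by
    have := LinearMap.BilinForm.finrank_orthogonal hnd W
    omega
  have hmem : ∀ z, B z k = 0 → (∀ i, B z (e i) = 0) → z ∈ B.orthogonal W := by
    intro z hz hze
    rw [LinearMap.BilinForm.mem_orthogonal_iff]
    intro w hw
    change B w z = 0
    rw [hsymm]
    have hle : W ≤ LinearMap.ker (B z) := by
      rw [hW, Submodule.span_le]
      rintro _ ⟨i, rfl⟩
      refine Fin.cases ?_ (fun i ↦ ?_) i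
      · simpa using hz
      · simpa using hze i
    exact hle hw
  have hk' : (⟨k, hmem k hkk fun i ↦ by rw [hsymm, hek]⟩ : B.orthogonal W) ≠ 0 := by
    intro h
    exact hk (congrArg Subtype.val h)
  obtain ⟨c, hc⟩ := exists_smul_eq_of_finrank_eq_one hort hk' ⟨y, hmem y hyk hye⟩
  exact ⟨c, congrArg Subtype.val hc⟩

/-- If an endomorphism `A` kills a null vector `k` and maps into `k^⊥`, then its trace is the trace
of `⟨A ·, ·⟩` over any maximal spacelike subspace of `k^⊥`: with `P` the orthogonal projection onto
the subspace, `(1 - P) A` kills `k` and maps everything to multiples of `k`, hence has square zero. -/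
theorem gram_trace_eq_trace [FiniteDimensional ℝ T] {m : ℕ}
    (hdim : Module.finrank ℝ T = m + 2)
    (B : LinearMap.BilinForm ℝ T) (hsymm : ∀ u v, B u v = B v u) (hnd : B.Nondegenerate)
    {k : T} (hk : k ≠ 0) (hkk : B k k = 0) (e : Fin m → T)
    (he : ∀ c : Fin m → ℝ, c ≠ 0 → 0 < B (∑ i, c i • e i) (∑ i, c i • e i))
    (hek : ∀ i, B (e i) k = 0) (A : T →ₗ[ℝ] T) (hAk : A k = 0) (hA : ∀ u, B (A u) k = 0) :
    ∑ α, ∑ β, (Matrix.of fun i j ↦ B (e i) (e j))⁻¹ α β * B (A (e α)) (e β) =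
      LinearMap.trace ℝ T A := by
  set G : Matrix (Fin m) (Fin m) ℝ := Matrix.of fun i j ↦ B (e i) (e j) with hG
  have hdet : IsUnit G.det := by
    refine isUnit_det_gram B e fun c hc ↦ ?_
    by_contra h0
    have := he c h0
    rw [map_sum, Finset.sum_eq_zero] at this
    · exact lt_irrefl _ this
    · intro i _
      rw [map_smul, hsymm, hc, smul_zero]
  let P : T →ₗ[ℝ] T := ∑ α, ∑ β, G⁻¹ α β • (B (e β)).smulRight (e α)
  have hP : ∀ x, P x = ∑ α, ∑ β, (G⁻¹ α β * B (e β) x) • e α := by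
    intro x
    simp [P, LinearMap.sum_apply, mul_smul]
  have hPe : ∀ x γ, B (P x) (e γ) = B x (e γ) := by
    intro x γ
    rw [hP]
    simp only [map_sum, LinearMap.sum_apply, map_smul, LinearMap.smul_apply, smul_eq_mul]
    rw [Finset.sum_comm]
    have : ∀ β, ∑ α, G⁻¹ α β * B (e β) x * B (e α) (e γ) = B x (e β) * (G * G⁻¹) γ β := by
      intro β
      rw [Matrix.mul_apply, Finset.mul_sum]
      refine Finset.sum_congr rfl fun α _ ↦ ?_
      rw [hG, Matrix.of_apply, hsymm (e γ), hsymm x]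
      ring
    simp only [this, Matrix.mul_nonsing_inv _ hdet, Matrix.one_apply]
    simp
  have hPk : ∀ x, B (P x) k = 0 := by
    intro x
    rw [hP]
    simp [map_sum, LinearMap.sum_apply, hek]
  have hQ : ∀ x, ∃ c : ℝ, c • k = (A - P ∘ₗ A) x := by
    intro x
    refine exists_smul_eq_of_orthogonal hdim B hsymm hnd hk hkk e he hek ?_ ?_
    · intro i
      simp [hPe]
    · simp [hPk, hA]
  have hnil : IsNilpotent (A - P ∘ₗ A) := by
    refine ⟨2, LinearMap.ext fun x ↦ ?_⟩
    obtain ⟨c, hc⟩ := hQ x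
    rw [pow_two, Module.End.mul_apply, ← hc]
    simp [hAk]
  have htr := (LinearMap.isNilpotent_trace_of_isNilpotent hnil).eq_zero
  rw [map_sub, sub_eq_zero] at htr
  rw [htr]
  have hPA : P ∘ₗ A = ∑ α, ∑ β, G⁻¹ α β • ((B (e β)) ∘ₗ A).smulRight (e α) := by
    ext x
    simp [P, LinearMap.sum_apply]
  rw [hPA]
  simp only [map_sum, map_smul, LinearMap.trace_smulRight, smul_eq_mul,
    LinearMap.comp_apply]
  refine Finset.sum_congr rfl fun α _ ↦ Finset.sum_congr rfl fun β _ ↦ ?_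
  rw [hsymm]

/-- A vector orthogonal to the kernel of `⟨k, ·⟩` is a multiple of `k`. -/
theorem exists_eq_smul_of_ker_le (B : T →ₗ[ℝ] T →ₗ[ℝ] ℝ) (hnd : ∀ u, (∀ v, B u v = 0) → u = 0)
    {k w : T} (h : ∀ u, B k u = 0 → B w u = 0) : ∃ c : ℝ, w = c • k := by
  have hle : (⨅ _ : Fin 1, LinearMap.ker (B k)) ≤ LinearMap.ker (B w) := by
    intro u hu
    simp only [ciInf_const, LinearMap.mem_ker] at hu ⊢
    exact h u hu
  have := mem_span_of_iInf_ker_le_ker (L := fun _ : Fin 1 ↦ B k) hle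
  simp only [Set.range_const, Submodule.mem_span_singleton] at this
  obtain ⟨c, hc⟩ := this
  refine ⟨c, sub_eq_zero.1 (hnd _ fun v ↦ ?_)⟩
  have := LinearMap.congr_fun hc v
  simp at this
  simp [this]

end BilinearForms

/-! ### Regularity of the gradient and of the wave operator -/

section SmoothMatrices

variable {E : Type*} [NormedAddCommGroup E] [NormedSpace ℝ E] {H : Type*} [TopologicalSpace H]
  {I : ModelWithCorners ℝ E H} {M : Type*} [TopologicalSpace M] [ChartedSpace H M]

theorem ContMDiffAt.matrix_det {r : ℕ∞ω} {m : ℕ} {A : M → Matrix (Fin m) (Fin m) ℝ} {p : M}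
    (hA : ∀ i j, ContMDiffAt I 𝓘(ℝ, ℝ) r (fun q ↦ A q i j) p) :
    ContMDiffAt I 𝓘(ℝ, ℝ) r (fun q ↦ (A q).det) p := by
  simp only [Matrix.det_apply]
  refine contMDiffAt_finsetSum fun σ _ ↦ ?_
  simp only [Units.smul_def, zsmul_eq_mul]
  exact contMDiffAt_const.mul (contMDiffAt_finsetProd fun i _ ↦ hA _ _)

theorem ContMDiffAt.matrix_inv {r : ℕ∞ω} {m : ℕ} {A : M → Matrix (Fin m) (Fin m) ℝ} {p : M}
    (hA : ∀ i j, ContMDiffAt I 𝓘(ℝ, ℝ) r (fun q ↦ A q i j) p) (hp : IsUnit (A p).det)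
    (i j : Fin m) :
    ContMDiffAt I 𝓘(ℝ, ℝ) r (fun q ↦ (A q)⁻¹ i j) p := by
  simp only [Matrix.inv_def, Matrix.smul_apply, smul_eq_mul, Ring.inverse_eq_inv',
    Matrix.adjugate_apply]
  refine ((ContMDiffAt.matrix_det hA).inv₀ hp.ne_zero).mul (ContMDiffAt.matrix_det fun k l ↦ ?_)
  by_cases h : k = j
  · subst h
    simpa using contMDiffAt_const
  · simpa [Matrix.updateRow_ne h] using hA k l

end SmoothMatrices

namespace Spacetime

variable {n : ℕ} {M : Type*} [TopologicalSpace M]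
  [ChartedSpace (EuclideanSpace ℝ (Fin (n + 1))) M] [IsManifold (𝓡 (n + 1)) ∞ M]
  (S : Spacetime n M)

theorem isManifold_two : IsManifold (𝓡 (n + 1)) 2 M :=
  IsManifold.of_le (n := ∞) (WithTop.coe_le_coe.2 (le_top : (2 : ℕ∞) ≤ ⊤))

/-- The vector field `X` is of class `C^r` at `p`. -/
abbrev CDiffAt (r : ℕ∞ω) (X : Π x : M, TangentSpace (𝓡 (n + 1)) x) (p : M) : Prop :=
  ContMDiffAt (𝓡 (n + 1)) (𝓡 (n + 1)).tangent r
    (fun x ↦ (⟨x, X x⟩ : TangentBundle (𝓡 (n + 1)) M)) p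

variable {r : ℕ∞ω} {X Y : Π x : M, TangentSpace (𝓡 (n + 1)) x} {p : M}

theorem CDiffAt.diffAt (h : CDiffAt 1 X p) : DiffAt X p :=
  h.mdifferentiableAt one_ne_zero

theorem contMDiffAt_pairing (hr : r ≤ ∞) (hX : CDiffAt r X p) (hY : CDiffAt r Y p) :
    ContMDiffAt (𝓡 (n + 1)) 𝓘(ℝ, ℝ) r (S.pairing X Y) p := by
  have h : ContMDiffAt (𝓡 (n + 1)) ((𝓡 (n + 1)).prod 𝓘(ℝ, ℝ)) r
      (fun m ↦ TotalSpace.mk' ℝ (E := Bundle.Trivial M ℝ) m (S.metric m (X m) (Y m))) p := by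
    apply ContMDiffAt.clm_bundle_apply₂ (F₁ := EuclideanSpace ℝ (Fin (n + 1)))
      (F₂ := EuclideanSpace ℝ (Fin (n + 1)))
    · exact S.smooth.contMDiffAt.of_le hr
    · exact hX
    · exact hY
  simp only [contMDiffAt_totalSpace] at h
  exact h.2

/-- The metric at `p` as an algebraic bilinear form. -/
noncomputable def metricForm (p : M) : LinearMap.BilinForm ℝ (TangentSpace (𝓡 (n + 1)) p) :=
  LinearMap.mk₂ ℝ (fun u v ↦ S.metric p u v) (by simp) (by simp) (by simp) (by simp)

theorem metricForm_nondegenerate (p : M) : (S.metricForm p).Nondegenerate :=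
  ⟨fun u hu ↦ S.metric_nondegenerate p u hu,
    fun u hu ↦ S.metric_nondegenerate p u fun v ↦ (S.symm p u v).trans (hu v)⟩

/-- The derivative of a `C^{r+1}` function along a `C^r` vector field is `C^r`. -/
theorem contMDiffAt_mvfderiv_apply {f : M → ℝ} {r' : ℕ∞ω}
    (hf : ContMDiffAt (𝓡 (n + 1)) 𝓘(ℝ, ℝ) r' f p) (hr : r + 1 ≤ r') (hX : CDiffAt r X p) :
    ContMDiffAt (𝓡 (n + 1)) 𝓘(ℝ, ℝ) r (fun q ↦ mvfderiv (𝓡 (n + 1)) f q (X q)) p := by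
  have h1 := hf.mfderiv_const hr
  have h2 : ContMDiffAt (𝓡 (n + 1)) 𝓘(ℝ, ℝ).tangent r
      (fun m ↦ (⟨f m, mfderiv (𝓡 (n + 1)) 𝓘(ℝ, ℝ) f m (X m)⟩ : TangentBundle 𝓘(ℝ, ℝ) ℝ)) p :=
    ContMDiffAt.clm_apply_of_inCoordinates h1 hX (hf.of_le (le_trans le_self_add hr))
  rw [contMDiffAt_totalSpace] at h2
  have h3 := h2.2
  simp only [trivializationAt_model_space_apply] at h3
  exact h3

/-- The coordinate frame of the tangent bundle near `p`. -/
noncomputable def frame (p : M) (i : Fin (n + 1)) (q : M) : TangentSpace (𝓡 (n + 1)) q :=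
  (trivializationAt (EuclideanSpace ℝ (Fin (n + 1))) (TangentSpace (𝓡 (n + 1))) p).localFrame
    (EuclideanSpace.basisFun (Fin (n + 1)) ℝ).toBasis i q

/-- The open set on which `frame p` is a frame. -/
noncomputable def frameDomain (p : M) : Set M :=
  (trivializationAt (EuclideanSpace ℝ (Fin (n + 1))) (TangentSpace (𝓡 (n + 1))) p).baseSet

theorem isLocalFrameOn_frame (p : M) :
    IsLocalFrameOn (𝓡 (n + 1)) (EuclideanSpace ℝ (Fin (n + 1))) ∞ (frame (n := n) p)
      (frameDomain (n := n) p) :=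
  Bundle.Trivialization.isLocalFrameOn_localFrame_baseSet ..

theorem frame_cdiffAt (p : M) (i : Fin (n + 1)) (hr : r ≤ ∞) :
    CDiffAt r (frame (n := n) p i) p :=
  ((isLocalFrameOn_frame (n := n) p).contMDiffAt (Trivialization.open_baseSet _)
    (FiberBundle.mem_baseSet_trivializationAt' p) i).of_le hr

theorem mem_frameDomain (p : M) : p ∈ frameDomain (n := n) p :=
  FiberBundle.mem_baseSet_trivializationAt' p

theorem frameDomain_mem_nhds (p : M) : frameDomain (n := n) p ∈ 𝓝 p :=
  (Trivialization.open_baseSet _).mem_nhds (mem_frameDomain p)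

/-- The basis of `T_qM` given by the coordinate frame near `p`. -/
noncomputable def frameBasis (p : M) {q : M} (hq : q ∈ frameDomain (n := n) p) :
    Module.Basis (Fin (n + 1)) ℝ (TangentSpace (𝓡 (n + 1)) q) :=
  (isLocalFrameOn_frame (n := n) p).toBasisAt hq

theorem frameBasis_apply (p : M) {q : M} (hq : q ∈ frameDomain (n := n) p) (i : Fin (n + 1)) :
    frameBasis p hq i = frame p i q :=
  IsLocalFrameOn.toBasisAt_coe ..

/-- The Gram matrix of the coordinate frame near `p`. -/
noncomputable def frameGram (p q : M) : Matrix (Fin (n + 1)) (Fin (n + 1)) ℝ :=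
  Matrix.of fun i j ↦ S.metric q (frame p i q) (frame p j q)

theorem isUnit_det_frameGram (p : M) {q : M} (hq : q ∈ frameDomain (n := n) p) :
    IsUnit (S.frameGram p q).det := by
  refine isUnit_det_gram (S.metricForm q) (fun i ↦ frame p i q) fun c hc ↦ ?_
  have h0 : ∑ i, c i • frame p i q = 0 := by
    generalize ∑ i, c i • frame p i q = w at hc
    refine S.metric_nondegenerate q _ fun v ↦ ?_
    rw [← (frameBasis p hq).sum_repr v, map_sum]
    refine Finset.sum_eq_zero fun i _ ↦ ?_
    rw [map_smul, frameBasis_apply, S.symm]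
    exact (congrArg _ (hc i)).trans (smul_zero _)
  ext i
  exact Fintype.linearIndependent_iff.1 ((isLocalFrameOn_frame (n := n) p).linearIndependent hq)
    c h0 i

theorem contMDiffAt_inv_frameGram (p : M) (hr : r ≤ ∞) (i j : Fin (n + 1)) :
    ContMDiffAt (𝓡 (n + 1)) 𝓘(ℝ, ℝ) r (fun q ↦ (S.frameGram p q)⁻¹ i j) p :=
  ContMDiffAt.matrix_inv (fun k l ↦ S.contMDiffAt_pairing hr (frame_cdiffAt p k hr)
    (frame_cdiffAt p l hr)) (S.isUnit_det_frameGram p (mem_frameDomain p)) i j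

/-- The components of a vector in the coordinate frame, in terms of its inner products with the
frame. -/
theorem frameBasis_repr (p : M) {q : M} (hq : q ∈ frameDomain (n := n) p)
    (v : TangentSpace (𝓡 (n + 1)) q) (i : Fin (n + 1)) :
    (frameBasis p hq).repr v i = ∑ j, (S.frameGram p q)⁻¹ i j * S.metric q v (frame p j q) := by
  have h : (fun j ↦ S.metric q v (frame p j q)) =
      (S.frameGram p q).mulVec ((frameBasis p hq).repr v) := by
    ext j
    conv_lhs => rw [← (frameBasis p hq).sum_repr v]
    rw [S.symm]
    simp only [map_sum, map_smul, frameBasis_apply, Matrix.mulVec, dotProduct, frameGram,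
      Matrix.of_apply, smul_eq_mul]
    exact Finset.sum_congr rfl fun _ _ ↦ mul_comm _ _
  change _ = ((S.frameGram p q)⁻¹.mulVec fun j ↦ S.metric q v (frame p j q)) i
  rw [h, Matrix.mulVec_mulVec, Matrix.nonsing_inv_mul _ (S.isUnit_det_frameGram p hq),
    Matrix.one_mulVec]

/-- A vector field is `C^r` if its inner products with the coordinate frame are: raising an index
preserves regularity. -/
theorem cdiffAt_of_pairing_frame (hr : r ≤ ∞)
    (h : ∀ i, ContMDiffAt (𝓡 (n + 1)) 𝓘(ℝ, ℝ) r (S.pairing X (frame p i)) p) :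
    CDiffAt r X p := by
  have key : CDiffAt r (fun q ↦ ∑ i, (∑ j, (S.frameGram p q)⁻¹ i j * S.pairing X (frame p j) q) •
      frame p i q) p := by
    refine ContMDiffAt.sum_section fun i _ ↦ ContMDiffAt.smul_section
      (contMDiffAt_finsetSum fun j _ ↦ ?_) (frame_cdiffAt p i hr)
    exact (S.contMDiffAt_inv_frameGram p hr i j).mul (h j)
  refine key.congr_of_eventuallyEq ?_
  filter_upwards [frameDomain_mem_nhds (n := n) p] with q hq
  congr 1
  conv_lhs => rw [← (frameBasis p hq).sum_repr (X q)]
  refine Finset.sum_congr rfl fun i _ ↦ ?_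
  rw [S.frameBasis_repr p hq, frameBasis_apply]
  rfl

theorem metric_grad (f : M → ℝ) (p : M) (v : TangentSpace (𝓡 (n + 1)) p) :
    S.metric p (S.grad f p) v = mvfderiv (𝓡 (n + 1)) f p v :=
  S.metric_raise p _ v

theorem pairing_grad (f : M → ℝ) (X : Π x : M, TangentSpace (𝓡 (n + 1)) x) :
    S.pairing (S.grad f) X = fun q ↦ mvfderiv (𝓡 (n + 1)) f q (X q) := by
  ext q
  exact S.metric_grad f q _

theorem cdiffAt_grad {f : M → ℝ} (hf : ContMDiffAt (𝓡 (n + 1)) 𝓘(ℝ, ℝ) 2 f p) :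
    CDiffAt 1 (S.grad f) p := by
  refine S.cdiffAt_of_pairing_frame (by simp) fun i ↦ ?_
  rw [pairing_grad]
  exact contMDiffAt_mvfderiv_apply hf (by norm_num) (frame_cdiffAt p i (by simp))

theorem contMDiffAt_koszul {N : Π x : M, TangentSpace (𝓡 (n + 1)) x} (hN : CDiffAt 1 N p)
    (hX : CDiffAt 1 X p) (hY : CDiffAt 1 Y p) :
    ContMDiffAt (𝓡 (n + 1)) 𝓘(ℝ, ℝ) 0 (fun q ↦ S.koszul q N X Y) p := by
  have hd : ∀ {U V W : Π x : M, TangentSpace (𝓡 (n + 1)) x}, CDiffAt 1 U p → CDiffAt 1 V p →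
      CDiffAt 1 W p → ContMDiffAt (𝓡 (n + 1)) 𝓘(ℝ, ℝ) 0
        (fun q ↦ mvfderiv (𝓡 (n + 1)) (S.pairing U V) q (W q)) p := fun hU hV hW ↦
    contMDiffAt_mvfderiv_apply (S.contMDiffAt_pairing (by simp) hU hV) (by simp)
      (hW.of_le (by simp))
  have hb : ∀ {U V W : Π x : M, TangentSpace (𝓡 (n + 1)) x}, CDiffAt 1 U p → CDiffAt 1 V p →
      CDiffAt 1 W p → ContMDiffAt (𝓡 (n + 1)) 𝓘(ℝ, ℝ) 0
        (fun q ↦ S.metric q (VectorField.mlieBracket (𝓡 (n + 1)) U V q) (W q)) p := by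
    intro U V W hU hV hW
    have : IsManifold (𝓡 (n + 1)) ((1 : ℕ∞) + 1) M :=
      IsManifold.of_le (n := ∞) (by exact_mod_cast le_top)
    have : IsManifold (𝓡 (n + 1)) (minSmoothness ℝ 2) M :=
      IsManifold.of_le (n := ∞) (by
        rw [minSmoothness_of_isRCLikeNormedField]
        exact WithTop.coe_le_coe.2 (le_top : (2 : ℕ∞) ≤ ⊤))
    exact S.contMDiffAt_pairing (by simp)
      (ContMDiffAt.mlieBracket_vectorField (m := 0) (n := 1) hU hV (by simp)) (hW.of_le (by simp))
  unfold koszul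
  simp only [div_eq_mul_inv]
  exact (((((((hd hN hY hX).add (hd hX hY hN)).sub (hd hX hN hY)).add (hb hX hN hY)).sub
    (hb hX hY hN)).sub (hb hN hY hX))).mul contMDiffAt_const

/-- The covariant derivative of a `C¹` field along a `C¹` field is continuous. -/
theorem cdiffAt_nabla {N : Π x : M, TangentSpace (𝓡 (n + 1)) x} (hN : ∀ᶠ q in 𝓝 p, CDiffAt 1 N q)
    (hX : ∀ᶠ q in 𝓝 p, CDiffAt 1 X q) :
    CDiffAt 0 (fun q ↦ S.nabla N q (X q)) p := by
  refine S.cdiffAt_of_pairing_frame (by simp) fun i ↦ ?_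
  refine (S.contMDiffAt_koszul hN.self_of_nhds hX.self_of_nhds
    (frame_cdiffAt p i (by simp))).congr_of_eventuallyEq ?_
  filter_upwards [hN, hX, frameDomain_mem_nhds (n := n) p] with q hq hXq hq'
  exact S.metric_nabla hq.diffAt hXq.diffAt
    (CDiffAt.diffAt (((isLocalFrameOn_frame (n := n) p).contMDiffAt (Trivialization.open_baseSet _)
      hq' i).of_le (by simp)))

/-- The trace of `∇∇f` is computed in a coordinate frame, where it is a sum of products of
continuous functions. -/
theorem continuous_box {f : M → ℝ} (hf : ContMDiff (𝓡 (n + 1)) 𝓘(ℝ, ℝ) 2 f) :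
    Continuous (S.box f) := by
  rw [continuous_iff_continuousAt]
  intro p
  have hN : ∀ q, CDiffAt 1 (S.grad f) q := fun q ↦ S.cdiffAt_grad hf.contMDiffAt
  have hE : ∀ i, ∀ q ∈ frameDomain (n := n) p, CDiffAt 1 (frame (n := n) p i) q := fun i q hq ↦
    ((isLocalFrameOn_frame (n := n) p).contMDiffAt (Trivialization.open_baseSet _) hq i).of_le
      (by simp)
  have key : ContMDiffAt (𝓡 (n + 1)) 𝓘(ℝ, ℝ) 0 (fun q ↦ ∑ i, ∑ j, (S.frameGram p q)⁻¹ i j *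
      S.metric q (S.nabla (S.grad f) q (frame p i q)) (frame p j q)) p := by
    refine contMDiffAt_finsetSum fun i _ ↦ contMDiffAt_finsetSum fun j _ ↦
      (S.contMDiffAt_inv_frameGram p (by simp) i j).mul ?_
    refine S.contMDiffAt_pairing (by simp) (S.cdiffAt_nabla (.of_forall hN) ?_)
      (frame_cdiffAt p j (by simp))
    filter_upwards [frameDomain_mem_nhds (n := n) p] with q hq using hE i q hq
  refine key.continuousAt.congr ?_
  filter_upwards [frameDomain_mem_nhds (n := n) p] with q hq
  rw [box, LinearMap.trace_eq_matrix_trace ℝ (frameBasis p hq), Matrix.trace]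
  refine Finset.sum_congr rfl fun i _ ↦ ?_
  rw [Matrix.diag_apply, LinearMap.toMatrix_apply, S.frameBasis_repr p hq, frameBasis_apply]

end Spacetime

/-! ### The Hessian of a function with null gradient -/

namespace Spacetime

section Derivatives

variable {n : ℕ} {M : Type*} [TopologicalSpace M]
  [ChartedSpace (EuclideanSpace ℝ (Fin (n + 1))) M] {p : M}

theorem mvfderiv_congr {f h : M → ℝ} (hfh : f =ᶠ[𝓝 p] h) :
    mvfderiv (𝓡 (n + 1)) f p = mvfderiv (𝓡 (n + 1)) h p := by
  rw [mvfderiv, mvfderiv, hfh.mfderiv_eq]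
  rw [hfh.self_of_nhds]

/-- A function that vanishes on `H` near `p` has vanishing derivative along `T_pH`. -/
theorem mvfderiv_eq_zero_of_mem_tangentTo {H : Set M} {h : M → ℝ}
    (hd : MDifferentiableAt (𝓡 (n + 1)) 𝓘(ℝ, ℝ) h p) (h0 : ∀ᶠ q in 𝓝[H] p, h q = 0)
    {u : TangentSpace (𝓡 (n + 1)) p} (hu : u ∈ tangentTo n H p) :
    mvfderiv (𝓡 (n + 1)) h p u = 0 := by
  have hle : tangentTo n H p ≤
      LinearMap.ker (mvfderiv (𝓡 (n + 1)) h p : TangentSpace (𝓡 (n + 1)) p →ₗ[ℝ] ℝ) := by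
    rw [tangentTo, Submodule.span_le]
    rintro v ⟨γ, hγ, hγH, hγv⟩
    have hp : γ 0 = p := congrArg TotalSpace.proj hγv
    subst hp
    have hv : mfderiv 𝓘(ℝ, ℝ) (𝓡 (n + 1)) γ 0 (1 : ℝ) = v := (TotalSpace.mk_inj ..).1 hγv
    have hcomp := mvfderiv_comp_apply (0 : ℝ) hd (hγ.mdifferentiableAt one_ne_zero) (1 : ℝ)
    have hzero : h ∘ γ =ᶠ[𝓝 (0 : ℝ)] fun _ ↦ 0 :=
      (tendsto_nhdsWithin_iff.2 ⟨hγ.continuousAt, hγH⟩).eventually h0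
    have hd0 : mvfderiv 𝓘(ℝ, ℝ) (h ∘ γ) (0 : ℝ) = 0 := by
      rw [mvfderiv, mfderiv_eq_fderiv, hzero.fderiv_eq, fderiv_fun_const]
      exact ContinuousLinearMap.comp_zero _
    rw [hd0] at hcomp
    rw [← hv]
    exact hcomp.symm
  exact hle hu

end Derivatives

variable {n : ℕ} {M : Type*} [TopologicalSpace M]
  [ChartedSpace (EuclideanSpace ℝ (Fin (n + 1))) M] [IsManifold (𝓡 (n + 1)) ∞ M]
  (S : Spacetime n M)
variable {r : ℕ∞ω} {X Y : Π x : M, TangentSpace (𝓡 (n + 1)) x} {p : M}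

/-- The derivative of a function along a vector field, read in the chart at `p`. -/
theorem fderiv_comp_extChartAt_symm_mpullback {f : M → ℝ} {x : EuclideanSpace ℝ (Fin (n + 1))}
    (hx : x ∈ (extChartAt (𝓡 (n + 1)) p).target)
    (hf : MDifferentiableAt (𝓡 (n + 1)) 𝓘(ℝ, ℝ) f ((extChartAt (𝓡 (n + 1)) p).symm x)) :
    fderiv ℝ (f ∘ (extChartAt (𝓡 (n + 1)) p).symm) x
      (VectorField.mpullbackWithin 𝓘(ℝ, EuclideanSpace ℝ (Fin (n + 1))) (𝓡 (n + 1))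
        (extChartAt (𝓡 (n + 1)) p).symm X (Set.range (𝓡 (n + 1))) x) =
      mvfderiv (𝓡 (n + 1)) f ((extChartAt (𝓡 (n + 1)) p).symm x)
        (X ((extChartAt (𝓡 (n + 1)) p).symm x)) := by
  have hinv := isInvertible_mfderivWithin_extChartAt_symm (I := 𝓡 (n + 1)) (x := p) hx
  have hd := mdifferentiableWithinAt_extChartAt_symm (I := 𝓡 (n + 1)) (x := p) hx
  have hcomp := mvfderiv_comp_mfderivWithin x hf hd
    (by simpa using! uniqueMDiffWithinAt_univ _)
  rw [VectorField.mpullbackWithin_apply]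
  have h1 : fderiv ℝ (f ∘ (extChartAt (𝓡 (n + 1)) p).symm) x =
      mvfderivWithin 𝓘(ℝ, EuclideanSpace ℝ (Fin (n + 1)))
        (f ∘ (extChartAt (𝓡 (n + 1)) p).symm) (Set.range (𝓡 (n + 1))) x := by
    simp only [modelWithCornersSelf_coe, Set.range_id, mvfderivWithin_univ]
    rw [mvfderiv, mfderiv_eq_fderiv]
    rfl
  rw [h1, hcomp]
  exact congrArg (mvfderiv (𝓡 (n + 1)) f _) (hinv.self_apply_inverse _)

/-- The Lie bracket acts on `C²` functions as the commutator of derivatives. -/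
theorem mvfderiv_mlieBracket {f : M → ℝ} (hf : ContMDiff (𝓡 (n + 1)) 𝓘(ℝ, ℝ) 2 f)
    (hX : DiffAt X p) (hY : DiffAt Y p)
    (hXf : MDifferentiableAt (𝓡 (n + 1)) 𝓘(ℝ, ℝ) (fun q ↦ mvfderiv (𝓡 (n + 1)) f q (X q)) p)
    (hYf : MDifferentiableAt (𝓡 (n + 1)) 𝓘(ℝ, ℝ) (fun q ↦ mvfderiv (𝓡 (n + 1)) f q (Y q)) p) :
    mvfderiv (𝓡 (n + 1)) f p (VectorField.mlieBracket (𝓡 (n + 1)) X Y p) =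
      mvfderiv (𝓡 (n + 1)) (fun q ↦ mvfderiv (𝓡 (n + 1)) f q (Y q)) p (X p) -
        mvfderiv (𝓡 (n + 1)) (fun q ↦ mvfderiv (𝓡 (n + 1)) f q (X q)) p (Y p) := by
  set φ := extChartAt (𝓡 (n + 1)) p with hφ
  have hfd : ∀ q, MDifferentiableAt (𝓡 (n + 1)) 𝓘(ℝ, ℝ) f q := fun q ↦
    hf.mdifferentiableAt (by norm_num)
  set X' : EuclideanSpace ℝ (Fin (n + 1)) → EuclideanSpace ℝ (Fin (n + 1)) :=
     VectorField.mpullbackWithin 𝓘(ℝ, EuclideanSpace ℝ (Fin (n + 1))) (𝓡 (n + 1))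
        φ.symm X (Set.range (𝓡 (n + 1))) with hX'
  set Y' : EuclideanSpace ℝ (Fin (n + 1)) → EuclideanSpace ℝ (Fin (n + 1)) :=
     VectorField.mpullbackWithin 𝓘(ℝ, EuclideanSpace ℝ (Fin (n + 1))) (𝓡 (n + 1))
        φ.symm Y (Set.range (𝓡 (n + 1))) with hY'
  have hpt : φ p ∈ φ.target := mem_extChartAt_target p
  have hsp : φ.symm (φ p) = p := extChartAt_to_inv p
  have htn : φ.target ∈ 𝓝 (φ p) := by
    have := extChartAt_target_mem_nhdsWithin (I := 𝓡 (n + 1)) p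
    rwa [modelWithCornersSelf_coe, Set.range_id, nhdsWithin_univ] at this
  have huniv : φ.symm ⁻¹' Set.univ ∩ Set.range (𝓡 (n + 1)) = Set.univ := by
    rw [Set.preimage_univ, Set.univ_inter, modelWithCornersSelf_coe, Set.range_id]
  have hXd : DifferentiableAt ℝ X' (φ p) :=
    (hX.mdifferentiableWithinAt (s := Set.univ)
      ).differentiableWithinAt_mpullbackWithin_vectorField.differentiableAt
      (huniv ▸ univ_mem)
  have hYd : DifferentiableAt ℝ Y' (φ p) :=
    (hY.mdifferentiableWithinAt (s := Set.univ)
      ).differentiableWithinAt_mpullbackWithin_vectorField.differentiableAt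
      (huniv ▸ univ_mem)
  have hF : ContDiffAt ℝ 2 (f ∘ φ.symm) (φ p) := by
    rw [← contMDiffAt_iff_contDiffAt]
    refine ContMDiffAt.comp (φ p) hf.contMDiffAt ?_
    have := isManifold_two (n := n) (M := M)
    exact (contMDiffOn_extChartAt_symm p).contMDiffAt htn
  have key := VectorField.fderiv_apply_lieBracket hF
    (by rw [minSmoothness_of_isRCLikeNormedField]) hYd hXd
  -- The flat identity is transported back to the manifold, first the iterated derivatives and then
  -- the bracket.
  have e1 : (fun x ↦ fderiv ℝ (f ∘ φ.symm) x (Y' x)) =ᶠ[𝓝 (φ p)]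
      (fun q ↦ mvfderiv (𝓡 (n + 1)) f q (Y q)) ∘ φ.symm := by
    filter_upwards [htn] with x hx using fderiv_comp_extChartAt_symm_mpullback hx (hfd _)
  have e2 : (fun x ↦ fderiv ℝ (f ∘ φ.symm) x (X' x)) =ᶠ[𝓝 (φ p)]
      (fun q ↦ mvfderiv (𝓡 (n + 1)) f q (X q)) ∘ φ.symm := by
    filter_upwards [htn] with x hx using fderiv_comp_extChartAt_symm_mpullback hx (hfd _)
  rw [e1.fderiv_eq, e2.fderiv_eq] at key
  have keyX := fderiv_comp_extChartAt_symm_mpullback (X := X) hpt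
    (f := fun q ↦ mvfderiv (𝓡 (n + 1)) f q (Y q)) (by rw [← hφ, hsp]; exact hYf)
  have keyY := fderiv_comp_extChartAt_symm_mpullback (X := Y) hpt
    (f := fun q ↦ mvfderiv (𝓡 (n + 1)) f q (X q)) (by rw [← hφ, hsp]; exact hXf)
  have hpull : ∀ (h : M → ℝ) (Z : Π x : M, TangentSpace (𝓡 (n + 1)) x) (q : M), q = p →
      mvfderiv (𝓡 (n + 1)) h q (Z q) = mvfderiv (𝓡 (n + 1)) h p (Z p) := by
    rintro h Z q rfl
    rfl
  rw [← hpull _ X _ hsp, ← hpull _ Y _ hsp]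
  refine Eq.trans ?_ (key.trans (congrArg₂ (· - ·) keyX keyY))
  have hbr : mfderiv (𝓡 (n + 1)) 𝓘(ℝ, EuclideanSpace ℝ (Fin (n + 1))) φ p
      (VectorField.mlieBracket (𝓡 (n + 1)) X Y p) = VectorField.lieBracket ℝ X' Y' (φ p) := by
    have h1 := (isInvertible_mfderiv_extChartAt (I := 𝓡 (n + 1))
      (mem_extChartAt_source p)).self_apply_inverse (VectorField.lieBracketWithin ℝ X' Y'
        (φ.symm ⁻¹' Set.univ ∩ Set.range (𝓡 (n + 1))) (φ p))
    have h2 : ∀ s, s = Set.univ →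
        VectorField.lieBracketWithin ℝ X' Y' s (φ p) = VectorField.lieBracket ℝ X' Y' (φ p) := by
      rintro s rfl
      rw [VectorField.lieBracketWithin_univ]
    exact h1.trans (h2 _ huniv)
  rw [← hbr]
  have hfe : f =ᶠ[𝓝 p] (f ∘ φ.symm) ∘ φ := by
    filter_upwards [extChartAt_source_mem_nhds (I := 𝓡 (n + 1)) p] with q hq
    exact congrArg f ((extChartAt (𝓡 (n + 1)) p).left_inv hq).symm
  rw [mvfderiv_congr hfe, mvfderiv_comp_apply p (hF.differentiableAt (by norm_num)).mdifferentiableAt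
    (mdifferentiableAt_extChartAt (mem_chart_source _ p)), mvfderiv, mfderiv_eq_fderiv]
  rfl

/-- The Hessian of a `C²` function is symmetric, because the connection is torsion free. -/
theorem hessian_symm {f : M → ℝ} (hf : ContMDiff (𝓡 (n + 1)) 𝓘(ℝ, ℝ) 2 f) (p : M)
    (u w : TangentSpace (𝓡 (n + 1)) p) : S.hessian f p u w = S.hessian f p w u := by
  have hN : DiffAt (S.grad f) p := (S.cdiffAt_grad hf.contMDiffAt).diffAt
  have hX : DiffAt (FiberBundle.extend (EuclideanSpace ℝ (Fin (n + 1))) u) p :=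
    FiberBundle.mdifferentiableAt_extend ..
  have hY : DiffAt (FiberBundle.extend (EuclideanSpace ℝ (Fin (n + 1))) w) p :=
    FiberBundle.mdifferentiableAt_extend ..
  have hXp := FiberBundle.extend_apply_self (F := EuclideanSpace ℝ (Fin (n + 1))) u
  have hYp := FiberBundle.extend_apply_self (F := EuclideanSpace ℝ (Fin (n + 1))) w
  generalize FiberBundle.extend (EuclideanSpace ℝ (Fin (n + 1))) u = X at hX hXp
  generalize FiberBundle.extend (EuclideanSpace ℝ (Fin (n + 1))) w = Y at hY hYp
  subst hXp hYp
  have h1 := S.nabla_metric hX hN hY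
  have h2 := S.nabla_metric hY hN hX
  have hXf := S.pairing_mdifferentiableAt hN hX
  have hYf := S.pairing_mdifferentiableAt hN hY
  rw [pairing_grad] at h1 h2 hXf hYf
  have h3 := mvfderiv_mlieBracket hf hX hY hXf hYf
  rw [← S.nabla_torsionFree hX hY, map_sub, ← S.metric_grad, ← S.metric_grad] at h3
  simp only [hessian]
  linarith

/-- If the gradient of `f` is null everywhere, then `⟨∇_u ∇f, ∇f⟩ = 0`. -/
theorem hessian_grad_right {f : M → ℝ} (hf : ContMDiff (𝓡 (n + 1)) 𝓘(ℝ, ℝ) 2 f)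
    (hnull : ∀ q, S.metric q (S.grad f q) (S.grad f q) = 0) (p : M)
    (u : TangentSpace (𝓡 (n + 1)) p) : S.hessian f p u (S.grad f p) = 0 := by
  have hN : DiffAt (S.grad f) p := (S.cdiffAt_grad hf.contMDiffAt).diffAt
  have hX : DiffAt (FiberBundle.extend (EuclideanSpace ℝ (Fin (n + 1))) u) p :=
    FiberBundle.mdifferentiableAt_extend ..
  have h1 := S.nabla_metric hX hN hN
  have h0 : S.pairing (S.grad f) (S.grad f) = fun _ ↦ (0 : ℝ) := funext hnull
  rw [h0, mvfderiv_const, FiberBundle.extend_apply_self, S.symm p (S.grad f p)] at h1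
  have h2 : (0 : ℝ) = S.hessian f p u (S.grad f p) + S.hessian f p u (S.grad f p) := h1
  linarith

/-- The integral curves of a null gradient are geodesics: `∇_{∇f} ∇f = 0`. -/
theorem nabla_grad_grad {f : M → ℝ} (hf : ContMDiff (𝓡 (n + 1)) 𝓘(ℝ, ℝ) 2 f)
    (hnull : ∀ q, S.metric q (S.grad f q) (S.grad f q) = 0) (p : M) :
    S.nabla (S.grad f) p (S.grad f p) = 0 :=
  S.metric_nondegenerate p _ fun v ↦
    (S.hessian_symm hf p (S.grad f p) v).trans (S.hessian_grad_right hf hnull p v)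

end Spacetime

/-! ### Level sets -/

/-- A nonzero functional on Euclidean space can be completed to linear coordinates: it is the
zeroth coordinate after a linear change of variables. -/
theorem exists_continuousLinearEquiv_apply_zero {n : ℕ}
    (ℓ : EuclideanSpace ℝ (Fin (n + 1)) →L[ℝ] ℝ) (hℓ : ℓ ≠ 0) :
    ∃ L : EuclideanSpace ℝ (Fin (n + 1)) ≃L[ℝ] EuclideanSpace ℝ (Fin (n + 1)),
      ∀ x, L x 0 = ℓ x := by
  obtain ⟨i, hi⟩ : ∃ i, ℓ (EuclideanSpace.single i 1) ≠ 0 := by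
    by_contra! h
    refine hℓ (ContinuousLinearMap.coe_injective
      ((EuclideanSpace.basisFun (Fin (n + 1)) ℝ).toBasis.ext fun i ↦ ?_))
    simpa using h i
  -- The `i`-th coordinate is replaced by `ℓ` and moved to the zeroth place.
  let A : EuclideanSpace ℝ (Fin (n + 1)) →ₗ[ℝ] EuclideanSpace ℝ (Fin (n + 1)) :=
    { toFun := fun x ↦ WithLp.toLp 2 fun j ↦ if j = 0 then ℓ x else x (Equiv.swap 0 i j)
      map_add' := fun x y ↦ by
        ext j
        by_cases hj : j = 0 <;> simp [hj]
      map_smul' := fun c x ↦ by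
        ext j
        by_cases hj : j = 0 <;> simp [hj] }
  have hA : ∀ x j, A x j = if j = 0 then ℓ x else x (Equiv.swap 0 i j) := fun x j ↦ rfl
  have hinj : Function.Injective A := by
    rw [← LinearMap.ker_eq_bot, LinearMap.ker_eq_bot']
    intro x hx
    have hx' : ∀ j, A x j = 0 := fun j ↦ by rw [hx]; rfl
    have hne : ∀ k, k ≠ i → x k = 0 := by
      intro k hk
      have h0 : Equiv.swap 0 i k ≠ 0 := by
        intro h
        apply hk
        have := congrArg (Equiv.swap 0 i) h
        rwa [Equiv.swap_apply_self, Equiv.swap_apply_left] at this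
      have := hx' (Equiv.swap 0 i k)
      rwa [hA, if_neg h0, Equiv.swap_apply_self] at this
    have hxs : x = x i • EuclideanSpace.single i 1 := by
      ext k
      by_cases hk : k = i
      · subst hk
        simp
      · simp [hne k hk, hk]
    have h0 := hx' 0
    rw [hA, if_pos rfl, hxs, map_smul, smul_eq_mul] at h0
    rw [hxs, (mul_eq_zero.1 h0).resolve_right hi, zero_smul]
  refine ⟨(LinearEquiv.ofInjectiveEndo A hinj).toContinuousLinearEquiv, fun x ↦ ?_⟩
  exact (hA x 0).trans (if_pos rfl)

namespace Spacetime

variable {n : ℕ} {M : Type*} [TopologicalSpace M]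
  [ChartedSpace (EuclideanSpace ℝ (Fin (n + 1))) M] [IsManifold (𝓡 (n + 1)) ∞ M]

/-- Around a point where `df ≠ 0`, a `C²` function is, up to a constant, the zeroth coordinate of
some `C²` chart. -/
theorem exists_slice_chart {f : M → ℝ} (hf : ContMDiff (𝓡 (n + 1)) 𝓘(ℝ, ℝ) 2 f) {p : M}
    (hp : mvfderiv (𝓡 (n + 1)) f p ≠ 0) (c : ℝ) :
    ∃ φ ∈ IsManifold.maximalAtlas (𝓡 (n + 1)) 2 M,
      p ∈ φ.source ∧ ∀ q ∈ φ.source, φ q 0 = f q - c := by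
  have := isManifold_two (n := n) (M := M)
  set e := chartAt (EuclideanSpace ℝ (Fin (n + 1))) p with he
  have hem : e ∈ IsManifold.maximalAtlas (𝓡 (n + 1)) 2 M := IsManifold.chart_mem_maximalAtlas p
  have hpe : p ∈ e.source := mem_chart_source _ p
  have hae : e p ∈ e.target := e.map_source hpe
  have hesymm : ContMDiffAt (𝓡 (n + 1)) (𝓡 (n + 1)) 2 e.symm (e p) :=
    contMDiffAt_symm_of_mem_maximalAtlas hem hae
  have hep : ContMDiffAt (𝓡 (n + 1)) (𝓡 (n + 1)) 2 e p := contMDiffAt_of_mem_maximalAtlas hem hpe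
  have hF : ContDiffAt ℝ 2 (f ∘ e.symm) (e p) := by
    rw [← contMDiffAt_iff_contDiffAt]
    exact ContMDiffAt.comp (e p) hf.contMDiffAt hesymm
  have hFd : HasFDerivAt (f ∘ e.symm) (fderiv ℝ (f ∘ e.symm) (e p)) (e p) :=
    (hF.differentiableAt (by norm_num)).hasFDerivAt
  have hℓ : fderiv ℝ (f ∘ e.symm) (e p) ≠ 0 := by
    intro h0
    apply hp
    have hfe : f =ᶠ[𝓝 p] (f ∘ e.symm) ∘ e := by
      filter_upwards [e.open_source.mem_nhds hpe] with q hq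
      exact congrArg f (e.left_inv hq).symm
    rw [mvfderiv_congr hfe]
    ext v
    rw [mvfderiv_comp_apply p (hF.differentiableAt (by norm_num)).mdifferentiableAt
      (hep.mdifferentiableAt (by norm_num)), mvfderiv, mfderiv_eq_fderiv, h0]
    rfl
  obtain ⟨L, hL⟩ := exists_continuousLinearEquiv_apply_zero _ hℓ
  set ℓ := fderiv ℝ (f ∘ e.symm) (e p) with hℓdef
  let e₀ : EuclideanSpace ℝ (Fin (n + 1)) := EuclideanSpace.single 0 1
  let G : EuclideanSpace ℝ (Fin (n + 1)) → EuclideanSpace ℝ (Fin (n + 1)) :=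
    fun x ↦ L x + (((f ∘ e.symm) x - c) - ℓ x) • e₀
  have hG0 : ∀ x, G x 0 = (f ∘ e.symm) x - c := by
    intro x
    simp [G, e₀, hL]
  have hGc : ContDiffAt ℝ 2 G (e p) :=
    L.contDiff.contDiffAt.add (((hF.sub contDiffAt_const).sub ℓ.contDiff.contDiffAt).smul
      contDiffAt_const)
  have hGd : HasFDerivAt G (L : EuclideanSpace ℝ (Fin (n + 1)) →L[ℝ]
      EuclideanSpace ℝ (Fin (n + 1))) (e p) := by
    have h1 := L.hasFDerivAt (x := e p)
    have h2 := (((hFd.sub_const c).sub (ℓ.hasFDerivAt (x := e p)))).smul_const e₀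
    have h3 : HasFDerivAt G ((L : EuclideanSpace ℝ (Fin (n + 1)) →L[ℝ]
      EuclideanSpace ℝ (Fin (n + 1))) + (ℓ - ℓ).smulRight e₀) (e p) := h1.add h2
    have h4 : (L : EuclideanSpace ℝ (Fin (n + 1)) →L[ℝ] EuclideanSpace ℝ (Fin (n + 1))) +
        (ℓ - ℓ).smulRight e₀ = L := by
      ext x
      simp
    rwa [h4] at h3
  -- `G` has zeroth component `f - c` and invertible derivative `L`; the inverse function theorem
  -- makes it a local diffeomorphism `ψ`.
  let ψ := hGc.toOpenPartialHomeomorph G hGd (by norm_num)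
  have hψ : ∀ x, ψ x = G x := fun x ↦ rfl
  have hψs : e p ∈ ψ.source := hGc.mem_toOpenPartialHomeomorph_source hGd (by norm_num)
  have hψsymm : ContDiffAt ℝ 2 ψ.symm (ψ (e p)) := hGc.to_localInverse hGd (by norm_num)
  let φ₀ := e.trans ψ
  have hφ₀p : p ∈ φ₀.source := by
    rw [OpenPartialHomeomorph.trans_source]
    exact ⟨hpe, hψs⟩
  have hφ₀ : ContMDiffAt (𝓡 (n + 1)) (𝓡 (n + 1)) 2 φ₀ p :=
    ContMDiffAt.comp p (g := ψ) (f := e) (contMDiffAt_iff_contDiffAt.2 hGc) hep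
  have hφ₀s : ContMDiffAt (𝓡 (n + 1)) (𝓡 (n + 1)) 2 φ₀.symm (φ₀ p) := by
    refine ContMDiffAt.comp (φ₀ p) (g := e.symm) (f := ψ.symm) ?_
      (contMDiffAt_iff_contDiffAt.2 hψsymm)
    have : ψ.symm (φ₀ p) = e p := ψ.left_inv hψs
    rw [this]
    exact hesymm
  -- The regularity of the inverse is known only near the image of `p`, so the chart is restricted.
  have hev : ∀ᶠ q in 𝓝 p, ContMDiffAt (𝓡 (n + 1)) (𝓡 (n + 1)) 2 φ₀ q ∧
      ContMDiffAt (𝓡 (n + 1)) (𝓡 (n + 1)) 2 φ₀.symm (φ₀ q) :=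
    ((contMDiffAt_iff_contMDiffAt_nhds (by norm_num)).1 hφ₀).and
      (hφ₀.continuousAt.eventually ((contMDiffAt_iff_contMDiffAt_nhds (by norm_num)).1 hφ₀s))
  obtain ⟨W, hW, hWo, hpW⟩ := eventually_nhds_iff.1 hev
  have hsrc : (φ₀.restrOpen W hWo).source = φ₀.source ∩ W := φ₀.restrOpen_source W hWo
  refine ⟨φ₀.restrOpen W hWo, OpenPartialHomeomorph.mem_maximalAtlas_of_contMDiffOn _ ?_ ?_, ?_,
    ?_⟩
  · intro q hq
    rw [hsrc] at hq
    exact (hW q hq.2).1.contMDiffWithinAt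
  · intro y hy
    have hq := (φ₀.restrOpen W hWo).map_target hy
    have hr := (φ₀.restrOpen W hWo).right_inv hy
    rw [hsrc] at hq
    have := (hW _ hq.2).2
    rw [← hr]
    exact this.contMDiffWithinAt
  · rw [hsrc]
    exact ⟨hφ₀p, hpW⟩
  · intro q hq
    rw [hsrc, OpenPartialHomeomorph.trans_source] at hq
    refine (hG0 (e q)).trans ?_
    rw [Function.comp_apply, e.left_inv hq.1.1]

/-- An open piece of a level set of a function without critical points is a hypersurface. -/
theorem isHypersurface_level {f : M → ℝ} (hf : ContMDiff (𝓡 (n + 1)) 𝓘(ℝ, ℝ) 2 f)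
    (hreg : ∀ p, mvfderiv (𝓡 (n + 1)) f p ≠ 0) {U : Set M} (hU : IsOpen U) (c : ℝ) :
    IsHypersurface n {q : M | q ∈ U ∧ f q = c} := by
  intro p hp
  obtain ⟨φ, hφ, hpφ, hφ0⟩ := exists_slice_chart hf (hreg p) c
  have := isManifold_two (n := n) (M := M)
  refine ⟨φ.restr U, restr_mem_maximalAtlas _ hφ hU, ?_, ?_⟩
  · rw [φ.restr_source' U hU]
    exact ⟨hpφ, hp.1⟩
  · intro q hq
    rw [φ.restr_source' U hU] at hq
    have h0 : φ.restr U q 0 = f q - c := hφ0 q hq.1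
    rw [h0, sub_eq_zero]
    exact ⟨fun h ↦ h.2, fun h ↦ ⟨hq.2, h⟩⟩

/-- The kernel of `df` is tangent to the level sets of `f`: in a slice chart, straight lines
in its directions stay in the level set. -/
theorem mem_tangentTo_level {f : M → ℝ} (hf : ContMDiff (𝓡 (n + 1)) 𝓘(ℝ, ℝ) 2 f) {p : M}
    (hp : mvfderiv (𝓡 (n + 1)) f p ≠ 0) {U : Set M} (hU : U ∈ 𝓝 p)
    {v : TangentSpace (𝓡 (n + 1)) p} (hv : mvfderiv (𝓡 (n + 1)) f p v = 0) :
    v ∈ tangentTo n {q : M | q ∈ U ∧ f q = f p} p := by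
  obtain ⟨φ, hφ, hpφ, hφ0⟩ := exists_slice_chart hf hp (f p)
  have := isManifold_two (n := n) (M := M)
  have hφp : ContMDiffAt (𝓡 (n + 1)) (𝓡 (n + 1)) 2 φ p := contMDiffAt_of_mem_maximalAtlas hφ hpφ
  have hφs : ContMDiffAt (𝓡 (n + 1)) (𝓡 (n + 1)) 2 φ.symm (φ p) :=
    contMDiffAt_symm_of_mem_maximalAtlas hφ (φ.map_source hpφ)
  let w : EuclideanSpace ℝ (Fin (n + 1)) := mfderiv (𝓡 (n + 1)) (𝓡 (n + 1)) φ p v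
  let pr : EuclideanSpace ℝ (Fin (n + 1)) →L[ℝ] ℝ := EuclideanSpace.proj 0
  have hw : w 0 = 0 := by
    have hev : f =ᶠ[𝓝 p] (fun x ↦ pr x + f p) ∘ φ := by
      filter_upwards [φ.open_source.mem_nhds hpφ] with q hq
      have h0 : pr (φ q) = f q - f p := hφ0 q hq
      rw [Function.comp_apply, h0, sub_add_cancel]
    have hprd : HasFDerivAt (fun x ↦ pr x + f p) pr (φ p) := pr.hasFDerivAt.add_const _
    rw [mvfderiv_congr hev, mvfderiv_comp_apply p hprd.differentiableAt.mdifferentiableAt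
      (hφp.mdifferentiableAt (by norm_num)), mvfderiv, mfderiv_eq_fderiv, hprd.fderiv] at hv
    exact hv
  let ℓ : ℝ → EuclideanSpace ℝ (Fin (n + 1)) := fun t ↦ φ p + t • w
  have hℓ0 : ℓ 0 = φ p := by simp [ℓ]
  have hℓd : HasDerivAt ℓ w 0 := by
    have := ((hasDerivAt_id (0 : ℝ)).smul_const w).const_add (φ p)
    rw [one_smul] at this
    exact this
  have hℓc : ContMDiffAt 𝓘(ℝ, ℝ) (𝓡 (n + 1)) 2 ℓ 0 :=
    contMDiffAt_iff_contDiffAt.2 (contDiffAt_const.add (contDiffAt_id.smul contDiffAt_const))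
  have hφs' : ContMDiffAt (𝓡 (n + 1)) (𝓡 (n + 1)) 2 φ.symm (ℓ 0) := by rwa [hℓ0]
  have hγ : ContMDiffAt 𝓘(ℝ, ℝ) (𝓡 (n + 1)) 2 (φ.symm ∘ ℓ) 0 := ContMDiffAt.comp 0 hφs' hℓc
  have hγ0 : (φ.symm ∘ ℓ) 0 = p := by rw [Function.comp_apply, hℓ0, φ.left_inv hpφ]
  refine Submodule.subset_span ⟨φ.symm ∘ ℓ, hγ.of_le (by norm_num), ?_, ?_⟩
  · have h1 : ∀ᶠ t in 𝓝 (0 : ℝ), (φ.symm ∘ ℓ) t ∈ U := by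
      refine hγ.continuousAt.eventually ?_
      rw [hγ0]
      exact hU
    have h2 : ∀ᶠ t in 𝓝 (0 : ℝ), ℓ t ∈ φ.target := by
      refine hℓc.continuousAt.eventually ?_
      rw [hℓ0]
      exact φ.open_target.mem_nhds (φ.map_source hpφ)
    filter_upwards [h1, h2] with t ht1 ht2
    refine ⟨ht1, ?_⟩
    have h3 := hφ0 _ (φ.map_target ht2)
    have h4 := hφ0 p hpφ
    rw [φ.right_inv ht2] at h3
    have h5 : ℓ t 0 = φ p 0 + t * w 0 := rfl
    rw [hw, h4, h3] at h5
    change f (φ.symm (ℓ t)) = f p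
    linarith
  · have hd : mfderiv 𝓘(ℝ, ℝ) (𝓡 (n + 1)) (φ.symm ∘ ℓ) 0 (1 : ℝ) =
        mfderiv (𝓡 (n + 1)) (𝓡 (n + 1)) φ.symm (ℓ 0) w := by
      refine (mfderiv_comp_apply (0 : ℝ) (hφs'.mdifferentiableAt (by norm_num))
        (hℓc.mdifferentiableAt (by norm_num)) (1 : ℝ)).trans ?_
      refine congrArg (mfderiv (𝓡 (n + 1)) (𝓡 (n + 1)) φ.symm (ℓ 0)) ?_
      rw [mfderiv_eq_fderiv, hℓd.hasFDerivAt.fderiv]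
      exact one_smul ℝ w
    have hid : mfderiv (𝓡 (n + 1)) (𝓡 (n + 1)) φ.symm (φ p) w = v := by
      have hev : φ.symm ∘ φ =ᶠ[𝓝 p] id := by
        filter_upwards [φ.open_source.mem_nhds hpφ] with q hq using φ.left_inv hq
      have h1 := mfderiv_comp_apply p (hφs.mdifferentiableAt (by norm_num))
        (hφp.mdifferentiableAt (by norm_num)) v
      rw [hev.mfderiv_eq] at h1
      refine h1.symm.trans ?_
      rw [mfderiv_id]
      rfl
    have hid' : ∀ y, y = φ p → mfderiv (𝓡 (n + 1)) (𝓡 (n + 1)) φ.symm y w = v := by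
      rintro y rfl
      exact hid
    have hv' : mfderiv 𝓘(ℝ, ℝ) (𝓡 (n + 1)) (φ.symm ∘ ℓ) 0 (1 : ℝ) = v := hd.trans (hid' _ hℓ0)
    exact TotalSpace.ext hγ0 (heq_of_eq hv')

end Spacetime

/-! ### Convexity of the level sets -/

namespace Spacetime

variable {n : ℕ} {M : Type*} [TopologicalSpace M]
  [ChartedSpace (EuclideanSpace ℝ (Fin (n + 1))) M] [IsManifold (𝓡 (n + 1)) ∞ M]
  (S : Spacetime n M)
variable {p : M}

/-- Two future vectors on the same line point in the same direction. -/
theorem pos_of_isFuture_smul {k N : TangentSpace (𝓡 (n + 1)) p} (hk : S.IsFuture k)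
    (hN : S.IsFuture N) {c : ℝ} (hc : N = c • k) : 0 < c := by
  obtain ⟨ho, hoo⟩ := S.orient_causal p
  obtain ⟨⟨hk0, -⟩, hk⟩ := hk
  obtain ⟨⟨hN0, -⟩, hN⟩ := hN
  have hoN : S.metric p (S.orient p) N = c * S.metric p (S.orient p) k := by simp [hc]
  by_contra! hcn
  have hc0 : c < 0 := lt_of_le_of_ne hcn (by rintro rfl; exact hN0 (by simp [hc]))
  rcases hk with hk | ⟨a, ha, rfl⟩
  · rcases hN with hN | ⟨b, hb, rfl⟩
    · nlinarith
    · have h1 : S.metric p (S.orient p) (b • S.orient p) =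
        b * S.metric p (S.orient p) (S.orient p) := by simp
      nlinarith [mul_pos_of_neg_of_neg hc0 hk]
  · rw [map_smul, smul_eq_mul] at hoN
    rcases hN with hN | ⟨b, hb, rfl⟩
    · have := mul_nonneg_of_nonpos_of_nonpos hc0.le
        (mul_nonpos_of_nonneg_of_nonpos ha.le hoo)
      linarith
    · rw [smul_smul] at hc
      have h1 : b = c * a := smul_left_injective ℝ ho hc
      nlinarith

theorem mvfderiv_ne_zero {f : M → ℝ} (h : S.grad f p ≠ 0) : mvfderiv (𝓡 (n + 1)) f p ≠ 0 := by
  intro h0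
  refine h (S.metric_nondegenerate p _ fun v ↦ ?_)
  rw [metric_grad, h0]
  rfl

/-- The gradient is normal to the level sets. -/
theorem isNormalTo_grad {f : M → ℝ} (hf : MDifferentiableAt (𝓡 (n + 1)) 𝓘(ℝ, ℝ) f p)
    {H : Set M} {c : ℝ} (hH : ∀ q ∈ H, f q = c) : S.IsNormalTo H p (S.grad f p) := by
  intro u hu
  rw [metric_grad]
  have h0 : mvfderiv (𝓡 (n + 1)) (fun q ↦ f q - c) p u = 0 :=
    mvfderiv_eq_zero_of_mem_tangentTo (hf.sub mdifferentiableAt_const)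
      (eventually_mem_nhdsWithin.mono fun q hq ↦ sub_eq_zero.2 (hH q hq)) hu
  rwa [mvfderiv_fun_sub hf mdifferentiableAt_const, mvfderiv_const, sub_zero] at h0

/-- Normal vectors to a level set are multiples of the gradient. -/
theorem exists_eq_smul_grad {f : M → ℝ} (hf : ContMDiff (𝓡 (n + 1)) 𝓘(ℝ, ℝ) 2 f)
    (h0 : S.grad f p ≠ 0) {U : Set M} (hU : U ∈ 𝓝 p) {N : TangentSpace (𝓡 (n + 1)) p}
    (hN : S.IsNormalTo {q | q ∈ U ∧ f q = f p} p N) : ∃ c : ℝ, N = c • S.grad f p := by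
  refine exists_eq_smul_of_ker_le (S.metricForm p) (S.metric_nondegenerate p) fun u hu ↦ ?_
  refine hN u (mem_tangentTo_level hf (S.mvfderiv_ne_zero h0) hU ?_)
  rw [← metric_grad]
  exact hu

/-- If the differentiable fields `N` and `K` are parallel along `H`, then their covariant
derivatives along `H` are, modulo the normal directions, in the same proportion. -/
theorem metric_nabla_of_parallel {N K : Π x : M, TangentSpace (𝓡 (n + 1)) x} {H : Set M}
    (hN : DiffAt N p) (hK : DiffAt K p) (hK0 : K p ≠ 0)
    (hpar : ∀ᶠ q in 𝓝[H] p, ∃ c : ℝ, N q = c • K q) {c : ℝ} (hc : N p = c • K p)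
    {u w : TangentSpace (𝓡 (n + 1)) p} (hu : u ∈ tangentTo n H p) (hw : S.metric p (K p) w = 0) :
    S.metric p (S.nabla N p u) w = c * S.metric p (S.nabla K p u) w := by
  obtain ⟨x, hx⟩ : ∃ x, S.metric p (K p) x ≠ 0 := by
    by_contra! h
    exact hK0 (S.metric_nondegenerate p _ h)
  have hY : DiffAt (FiberBundle.extend (EuclideanSpace ℝ (Fin (n + 1))) u) p :=
    FiberBundle.mdifferentiableAt_extend ..
  have hX : DiffAt (FiberBundle.extend (EuclideanSpace ℝ (Fin (n + 1))) x) p :=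
    FiberBundle.mdifferentiableAt_extend ..
  have hZ : DiffAt (FiberBundle.extend (EuclideanSpace ℝ (Fin (n + 1))) w) p :=
    FiberBundle.mdifferentiableAt_extend ..
  have hYp := FiberBundle.extend_apply_self (F := EuclideanSpace ℝ (Fin (n + 1))) u
  have hXp := FiberBundle.extend_apply_self (F := EuclideanSpace ℝ (Fin (n + 1))) x
  have hZp := FiberBundle.extend_apply_self (F := EuclideanSpace ℝ (Fin (n + 1))) w
  generalize FiberBundle.extend (EuclideanSpace ℝ (Fin (n + 1))) u = Y at hY hYp
  generalize FiberBundle.extend (EuclideanSpace ℝ (Fin (n + 1))) x = X at hX hXp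
  generalize FiberBundle.extend (EuclideanSpace ℝ (Fin (n + 1))) w = Z at hZ hZp
  subst hYp hXp hZp
  have hNZ := S.pairing_mdifferentiableAt hN hZ
  have hNX := S.pairing_mdifferentiableAt hN hX
  have hKZ := S.pairing_mdifferentiableAt hK hZ
  have hKX := S.pairing_mdifferentiableAt hK hX
  have hNZKX : MDifferentiableAt (𝓡 (n + 1)) 𝓘(ℝ, ℝ)
      (fun q ↦ S.pairing N Z q * S.pairing K X q) p := hNZ.mul hKX
  have hNXKZ : MDifferentiableAt (𝓡 (n + 1)) 𝓘(ℝ, ℝ)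
      (fun q ↦ S.pairing N X q * S.pairing K Z q) p := hNX.mul hKZ
  -- The minor `⟨N,Z⟩⟨K,X⟩ - ⟨N,X⟩⟨K,Z⟩` vanishes on `H`, hence so does its derivative along `u`.
  have hd := mvfderiv_eq_zero_of_mem_tangentTo
    (h := fun q ↦ S.pairing N Z q * S.pairing K X q - S.pairing N X q * S.pairing K Z q)
    (hNZKX.sub hNXKZ) (by
      filter_upwards [hpar] with q hq
      obtain ⟨a, ha⟩ := hq
      simp only [pairing, ha, map_smul, smul_apply, smul_eq_mul]
      ring) hu
  have hKZ0 : S.pairing K Z p = 0 := hw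
  have hNZ0 : S.pairing N Z p = 0 := by simp [pairing, hc, hw]
  have hNX0 : S.pairing N X p = c * S.pairing K X p := by simp [pairing, hc]
  have hKX0 : S.pairing K X p ≠ 0 := hx
  rw [mvfderiv_fun_sub hNZKX hNXKZ, mvfderiv_fun_mul hNZ hKX,
    mvfderiv_fun_mul hNX hKZ, hKZ0, hNZ0, hNX0] at hd
  have hd' : S.pairing K X p * mvfderiv (𝓡 (n + 1)) (S.pairing N Z) p (Y p) -
      c * S.pairing K X p * mvfderiv (𝓡 (n + 1)) (S.pairing K Z) p (Y p) = 0 := by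
    simpa using hd
  have h1 := S.nabla_metric hY hN hZ
  have h2 := S.nabla_metric hY hK hZ
  have h3 : S.metric p (N p) (S.nabla Z p (Y p)) = c * S.metric p (K p) (S.nabla Z p (Y p)) := by
    simp [hc]
  apply mul_left_cancel₀ hKX0
  rw [h1, h2, h3] at hd'
  linear_combination hd'

/-- For a function with everywhere null gradient, the trace of the Hessian over any section of the
tangent space of a level set is the wave operator. -/
theorem traceOn_hessian {f : M → ℝ} (hn : 2 ≤ n) (hf : ContMDiff (𝓡 (n + 1)) 𝓘(ℝ, ℝ) 2 f)
    (hnull : ∀ q, S.IsNull (S.grad f q)) {V : Submodule ℝ (TangentSpace (𝓡 (n + 1)) p)}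
    (hV : ∀ v ∈ V, S.metric p (S.grad f p) v = 0) (hVs : S.IsSpacelike V)
    (e : Module.Basis (Fin (n - 1)) ℝ V) :
    S.traceOn (fun i ↦ (e i : TangentSpace (𝓡 (n + 1)) p)) (S.hessian f p) = S.box f p := by
  have : FiniteDimensional ℝ (TangentSpace (𝓡 (n + 1)) p) :=
    inferInstanceAs (FiniteDimensional ℝ (EuclideanSpace ℝ (Fin (n + 1))))
  have hdim : Module.finrank ℝ (TangentSpace (𝓡 (n + 1)) p) = n - 1 + 2 := by
    have : Module.finrank ℝ (TangentSpace (𝓡 (n + 1)) p) = n + 1 :=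
      finrank_euclideanSpace_fin (𝕜 := ℝ)
    omega
  have hnull' : ∀ q, S.metric q (S.grad f q) (S.grad f q) = 0 := fun q ↦ (hnull q).2
  refine gram_trace_eq_trace hdim (S.metricForm p) (S.symm p) (S.metricForm_nondegenerate p)
    (hnull p).1 (hnull p).2 _ (fun c hc ↦ ?_) (fun i ↦ (S.symm p _ _).trans (hV _ (e i).2)) _
    (S.nabla_grad_grad hf hnull' p) (S.hessian_grad_right hf hnull' p)
  have hs : ∑ i, c i • (e i : TangentSpace (𝓡 (n + 1)) p) = ((∑ i, c i • e i : V) : _) := by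
    simp
  rw [hs]
  refine hVs _ (Subtype.coe_prop _) fun h0 ↦ hc ?_
  ext i
  exact Fintype.linearIndependent_iff.1 e.linearIndependent c (Subtype.ext h0) i

theorem traceOn_eq_mul {k : ℕ} {e : Fin k → TangentSpace (𝓡 (n + 1)) p}
    {K K' : TangentSpace (𝓡 (n + 1)) p → TangentSpace (𝓡 (n + 1)) p → ℝ} {c : ℝ}
    (h : ∀ i j, K (e i) (e j) = c * K' (e i) (e j)) : S.traceOn e K = c * S.traceOn e K' := by
  simp only [traceOn, h, Finset.mul_sum]
  exact Finset.sum_congr rfl fun i _ ↦ Finset.sum_congr rfl fun j _ ↦ by ring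

/-- A future normal field along the level set is a positive multiple `a` of the gradient there, so
its convexity trace is `a □f`. -/
theorem isStrictlyFutureConvexAt_level {f : M → ℝ} (hn : 2 ≤ n)
    (hf : ContMDiff (𝓡 (n + 1)) 𝓘(ℝ, ℝ) 2 f)
    (hnull : ∀ q, S.IsNull (S.grad f q) ∧ S.IsFuture (S.grad f q)) {U : Set M} (hU : IsOpen U)
    (hbox : ∀ q ∈ U, 0 < S.box f q) {c : ℝ} (hp : p ∈ {q | q ∈ U ∧ f q = c}) :
    S.IsStrictlyFutureConvexAt (n - 1) {q | q ∈ U ∧ f q = c} p := by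
  have hgrad : ∀ q, S.IsNormalTo {q | q ∈ U ∧ f q = c} q (S.grad f q) := fun q ↦
    S.isNormalTo_grad (hf.mdifferentiableAt (by norm_num)) fun _ hq ↦ hq.2
  refine ⟨⟨S.grad f, S.cdiffAt_grad hf.contMDiffAt,
    Eventually.of_forall fun q ↦ ⟨(hnull q).2, hgrad q⟩⟩, ?_⟩
  rintro N ⟨hN, hNH⟩ W hW hWs e
  have hpar : ∀ q ∈ {q | q ∈ U ∧ f q = c}, S.IsNormalTo {q | q ∈ U ∧ f q = c} q (N q) →
      ∃ a : ℝ, N q = a • S.grad f q := by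
    rintro q ⟨hqU, rfl⟩ hq
    exact S.exists_eq_smul_grad hf (hnull q).1.1 (hU.mem_nhds hqU) hq
  have hNp := hNH.self_of_nhdsWithin hp
  obtain ⟨a, ha⟩ := hpar p hp hNp.2
  have ha0 : 0 < a := S.pos_of_isFuture_smul (hnull p).2 hNp.1 ha
  have htr := S.traceOn_hessian hn hf (fun q ↦ (hnull q).1) (fun v hv ↦ hgrad p v (hW hv)) hWs e
  rw [S.traceOn_eq_mul (K' := S.hessian f p) (c := a), htr]
  · exact mul_pos ha0 (hbox p hp.1)
  · intro i j
    refine S.metric_nabla_of_parallel (H := {q | q ∈ U ∧ f q = c}) (CDiffAt.diffAt hN)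
      (S.cdiffAt_grad hf.contMDiffAt).diffAt (hnull p).1.1 ?_ ha (hW (e i).2)
      (hgrad p _ (hW (e j).2))
    filter_upwards [hNH, eventually_mem_nhdsWithin] with q hq hqH using hpar q hqH hq.2

end Spacetime

theorem mainTheorem6 {n : ℕ} (hn : 2 ≤ n) {M : Type*} [TopologicalSpace M] [T2Space M]
    [SecondCountableTopology M] [ChartedSpace (EuclideanSpace ℝ (Fin (n + 1))) M]
    [IsManifold (𝓡 (n + 1)) ∞ M] (S : Spacetime n M) (g : M → ℝ)
    (hg : ContMDiff (𝓡 (n + 1)) 𝓘(ℝ, ℝ) 2 g)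
    (hnull : ∀ p, S.IsNull (S.grad g p) ∧ S.IsFuture (S.grad g p)) :
    IsOpen {p : M | 0 < S.box g p} ∧
    (∀ c : ℝ, S.IsNullHypersurface {p : M | 0 < S.box g p ∧ g p = c} ∧
      S.IsStrictlyFutureConvex (n - 1) {p : M | 0 < S.box g p ∧ g p = c}) ∧
    (∀ (p : M) (V : Submodule ℝ (TangentSpace (𝓡 (n + 1)) p)),
      V ≤ Spacetime.tangentTo n {q : M | g q = g p} p → S.IsSpacelike V →
      ∀ e : Module.Basis (Fin (n - 1)) ℝ V,
        S.traceOn (fun i ↦ (e i : TangentSpace (𝓡 (n + 1)) p)) (S.hessian g p) = S.box g p) := by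
  have hopen : IsOpen {p : M | 0 < S.box g p} := isOpen_lt continuous_const (S.continuous_box hg)
  have hd : ∀ p, MDifferentiableAt (𝓡 (n + 1)) 𝓘(ℝ, ℝ) g p := fun p ↦
    hg.mdifferentiableAt (by norm_num)
  refine ⟨hopen, fun c ↦ ?_, fun p V hV hVs e ↦ ?_⟩
  · have hH := Spacetime.isHypersurface_level hg (fun p ↦ S.mvfderiv_ne_zero (hnull p).1.1) hopen c
    have hnormal : ∀ p, S.IsNormalTo {p : M | 0 < S.box g p ∧ g p = c} p (S.grad g p) := fun p ↦
      S.isNormalTo_grad (hd p) fun _ hq ↦ hq.2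
    exact ⟨⟨hH, fun p _ ↦ ⟨_, (hnull p).1, hnormal p⟩⟩,
      ⟨hH, fun p _ ↦ ⟨_, (hnull p).2.1, hnormal p⟩⟩,
      fun p hp ↦ S.isStrictlyFutureConvexAt_level hn hg hnull hopen (fun _ hq ↦ hq) hp⟩
  · exact S.traceOn_hessian hn hg (fun q ↦ (hnull q).1)
      (fun v hv ↦ S.isNormalTo_grad (hd p) (fun _ hq ↦ hq) v (hV hv)) hVs e
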